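/- **Conventions.** A locale $X$ has frame of opens $\mathcal O(X)$; a map of locales $f:X\to Y$ has inverse image $f^*:\mathcal O(Y)\to\mathcal O(X)$, and $f_!$ denotes the left adjoint of $f^*$ when it exists. The map $f$ is *open* if $f_!$ exists and $f_!(a\wedge f^*(b))=f_!(a)\wedge b$ for all $a,b$; it is an *open regular monomorphism* if moreover $f^*$ is surjective; it is a *local homeomorphism* if its domain is covered by open sublocales on which $f$ restricts to an open regular monomorphism. A *localic groupoid* $G$ is an internal groupoid in locales, with domain and range $d,r:G_1\to G_0$, units $u:G_0\to G_1$, inversion $i:G_1\to G_1$ and multiplication $m:G_2\to G_1$, where $G_2$ is the pullback of $r$ and $d$ with projections $\pi_1,\pi_2$ ($r\pi_1=d\pi_2$). It is *open* if $d$ is open and *étale* if $d$ is a local homeomorphism. Functors are internal functors. Let $G$ be an open localic groupoid. The quantale $\mathcal O(G)$ is the frame $\mathcal O(G_1)$ with $ab=m_!(\pi_1^*(a)\wedge\pi_2^*(b))$ and $a^*=i^*(a)$; its right-sided elements are identified with $\mathcal O(G_0)$ through $d^*$. A *local bisection* $\sigma=(U,s)$ is an open $U\in\mathcal O(G_0)$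 with a map $s$ from the open sublocale $U$ to $G_1$ such that $d\circ s$ is the inclusion of $U$ and $r\circ s$ is an open regular monomorphism. If $V$ is the image of $r\circ s$ and $\alpha:U\to V$ the induced isomorphism, then $\sigma^{-1}=(V,\,i\circ s\circ\alpha^{-1})$. The product $\sigma\tau$ has domain $s_\sigma^*(r^*(U_\tau))$ and section $m\circ\langle s_\sigma,\ s_\tau\circ(r\circ s_\sigma)\rangle$ on it. Let $\mathcal S(G)$ be the set of local bisections, ordered by restriction, and put $\varepsilon=(G_0,u)$. For $\sigma\in\mathcal S(G)$ and $a\in\mathcal O(G_1)$ put $$\sigma\cdot a=\bigvee_{x^*y\le a}d^*(s_\sigma^*(x))\wedge y .$$ Let $\widehat Q=\mathcal L^\vee(\mathcal S(G))$ be the frame of all subsets of $\mathcal S(G)$ that are downwards closed and closed under joins of compatible subsets (equivalently, under all joins that exist in $\mathcal S(G)$), ordered by inclusion. It is a unital involutive quantale: the product of $A$ and $B$ is generated by the products $\sigma\tau$ with $\sigma\in A$, $\tau\in B$, the involution $A^*$ is generated by the $\sigma^{-1}$ with $\sigma\in A$, and the unit is $e=\widehat\varepsilon$, where $\widehat\sigma=\{\tau\mid\tau\le\sigma\}$.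 Define $j:\mathcal O(G_1)\to\widehat Q$ by $j(a)=\{\sigma\in\mathcal S(G)\mid s_\sigma^*(a)=U_\sigma\}$. The groupoid $G$ is *weakly coverable* if $\widehat\sigma\,j(a)=j(\sigma\cdot a)$ for all $\sigma\in\mathcal S(G)$ and $a\in\mathcal O(G_1)$, and it *has enough bisections* if $j$ is injective. **Theorem.** Let $G$ be a weakly coverable open localic groupoid with enough bisections. Then there is an étale localic groupoid $\widehat G=\mathcal G(\widehat Q)$ with $\mathcal O(\widehat G_0)={\downarrow}e$, $\mathcal O(\widehat G_1)=\widehat Q$ and structure maps given by $d^*(b)=b1$, $r^*(b)=1b$, $u^*(a)=a\wedge e$, $i^*(a)=a^*$ and $m^*(a)=\bigvee_{xy\le a}x\otimes y$ (with $1$ the top element of $\widehat Q$ and $x\otimes y=\pi_1^*(x)\wedge\pi_2^*(y)$), and there is a functor of localic groupoids $J:\widehat G\to G$ such that $J_0:\widehat G_0\to G_0$ is the canonical isomorphism, $J_0^*(U)=\widehat{\varepsilon|_U}$ for $U\in\mathcal O(G_0)$, and $J_1:\widehat G_1\to G_1$ is given by $J_1^*=j$. Moreover, $J$ is an epimorphism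 in the category of localic groupoids, and it is an isomorphism if and only if $G$ is étale. -/

import Mathlib

open CategoryTheory

universe u

noncomputable section

/-! ## Locales: inverse and direct images, open maps, open sublocales, local homeomorphisms -/

/-- The down-segment `{b | b ≤ a}` of a frame is a frame. -/
instance Set.Iic.instFrameIic {α : Type*} [Order.Frame α] (a : α) : Order.Frame (Set.Iic a) :=
  Order.Frame.ofMinimalAxioms
    { inf_sSup_le_iSup_inf := by
        intro b s
        rw [← Subtype.coe_le_coe]
        have h : ((b ⊓ sSup s : Set.Iic a) : α) = (b : α) ⊓ sSup ((↑) '' s) := by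
          rw [Set.Iic.coe_inf, Set.Iic.coe_sSup]
        rw [h, inf_sSup_eq]
        refine iSup₂_le fun x hx => ?_
        obtain ⟨c, hc, rfl⟩ := hx
        exact Subtype.coe_le_coe.2 (le_iSup₂ (f := fun c (_ : c ∈ s) => b ⊓ c) c hc) }

namespace Locale

variable {X Y Z : Locale.{u}}

/-- The inverse image homomorphism `f^*` of a map of locales. The frame of opens of a locale `X`
is written `↥X`. -/
def invIm (f : X ⟶ Y) : FrameHom Y X := (Quiver.Hom.unop (V := Frm) f).hom

/-- The map of locales with a given inverse image. -/
def ofInvIm (φ : FrameHom Y X) : X ⟶ Y := Quiver.Hom.op (V := Frm) (Frm.ofHom φ)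

@[simp] theorem invIm_ofInvIm (φ : FrameHom Y X) : invIm (ofInvIm φ) = φ := rfl

@[simp] theorem invIm_comp (f : X ⟶ Y) (g : Y ⟶ Z) (c : Z) : invIm (f ≫ g) c = invIm f (invIm g c) := rfl

@[simp] theorem invIm_id (c : X) : invIm (𝟙 X) c = c := rfl

theorem hom_ext {f g : X ⟶ Y} (h : ∀ b, invIm f b = invIm g b) : f = g :=
  Quiver.Hom.unop_inj (C := Frm) (Frm.ext h)

/-- The direct image `f_!`. It is the left adjoint of `f^*` whenever a left adjoint exists. -/
def dirIm (f : X ⟶ Y) (a : X) : Y := sInf {b | a ≤ invIm f b}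

/-- A map of locales is open when `f^*` has a left adjoint `f_!` that satisfies the Frobenius
reciprocity condition. -/
def IsOpenMap (f : X ⟶ Y) : Prop :=
  GaloisConnection (dirIm f) (invIm f) ∧ ∀ (a : X) (b : Y), dirIm f (a ⊓ invIm f b) = dirIm f a ⊓ b

/-- Open regular monomorphisms of locales (open embeddings); the regular monomorphisms of locales
are the maps whose inverse image is surjective. -/
def IsOpenRegularMono (f : X ⟶ Y) : Prop :=
  IsOpenMap f ∧ Function.Surjective (invIm f)

theorem dirIm_eq_of_gc {f : X ⟶ Y} {g : X → Y} (h : GaloisConnection g (invIm f)) : dirIm f = g := by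
  funext a
  apply le_antisymm
  · exact sInf_le (h.le_u_l a)
  · exact le_sInf fun b hb => h.l_le hb

theorem isOpenMap_of_adjoint {f : X ⟶ Y} (g : X → Y) (h : GaloisConnection g (invIm f))
    (h' : ∀ a b, g (a ⊓ invIm f b) = g a ⊓ b) : IsOpenMap f := by
  rw [IsOpenMap, dirIm_eq_of_gc h]
  exact ⟨h, h'⟩

theorem IsOpenRegularMono.comp {f : X ⟶ Y} {g : Y ⟶ Z} (hf : IsOpenRegularMono f)
    (hg : IsOpenRegularMono g) : IsOpenRegularMono (f ≫ g) := by
  refine ⟨isOpenMap_of_adjoint (fun a => dirIm g (dirIm f a)) ?_ ?_, ?_⟩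
  · intro a c
    exact (hg.1.1 _ _).trans (hf.1.1 _ _)
  · intro a c
    simp only [invIm_comp, hf.1.2, hg.1.2]
  · intro a
    obtain ⟨b, rfl⟩ := hf.2 a
    obtain ⟨c, rfl⟩ := hg.2 b
    exact ⟨c, rfl⟩

/-- The open sublocale determined by `U`; its frame of opens is the down-segment of `U`. -/
def openSub (U : X) : Locale.{u} := Locale.of (Set.Iic U)

/-- An open of an open sublocale of `X`, regarded as an open of `X`. -/
def val {U : X} (a : openSub U) : X := Subtype.val (p := (· ∈ Set.Iic U)) a

theorem val_le {U : X} (a : openSub U) : val a ≤ U :=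
  Subtype.prop (p := (· ∈ Set.Iic U)) a

/-- An open contained in `U`, regarded as an open of the open sublocale of `U`. -/
def mk {U : X} (a : X) (h : a ≤ U) : openSub U := (⟨a, h⟩ : Set.Iic U)

@[simp] theorem val_mk {U : X} (a : X) (h : a ≤ U) : val (mk a h) = a := rfl

theorem val_injective {U : X} : Function.Injective (val : openSub U → X) :=
  Subtype.val_injective (p := (· ∈ Set.Iic U))

theorem val_le_val {U : X} {a b : openSub U} : val a ≤ val b ↔ a ≤ b := Iff.rfl

@[simp] theorem val_top {U : X} : val (⊤ : openSub U) = U := rfl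

@[simp] theorem val_inf {U : X} (a b : openSub U) : val (a ⊓ b) = val a ⊓ val b := rfl

theorem val_sSup {U : X} (s : Set (openSub U)) : val (sSup s) = sSup (val '' s) :=
  Set.Iic.coe_sSup (α := X) s

/-- A map of locales whose inverse image sends `V` to the top element factors through the open
sublocale of `V`. -/
def openLift (f : X ⟶ Y) (V : Y) (h : invIm f V = ⊤) : X ⟶ openSub V :=
  ofInvIm
    { toFun := fun v => invIm f (val v)
      map_inf' := fun a b => by simp
      map_top' := by simpa using h
      map_sSup' := fun s => by
        simp only [val_sSup, map_sSup, Set.image_image] }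

/-- The inclusion `k_U` of the open sublocale of `U`, with `k_U^*(a) = a ⊓ U`. -/
def openIncl (U : X) : openSub U ⟶ X :=
  ofInvIm
    { toFun := fun a => mk (a ⊓ U) inf_le_right
      map_inf' := fun a b => val_injective (by simp [inf_inf_distrib_right])
      map_top' := val_injective (by simp)
      map_sSup' := fun s => val_injective (by
        rw [val_mk, val_sSup, sSup_inf_eq, Set.image_image, sSup_image]
        rfl) }

@[simp] theorem val_invIm_openIncl (U a : X) : val (invIm (openIncl U) a) = a ⊓ U := rfl

@[simp] theorem invIm_openLift (f : X ⟶ Y) (V : Y) (h : invIm f V = ⊤) (v : openSub V) :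
    invIm (openLift f V h) v = invIm f (val v) := rfl

@[simp] theorem openLift_comp (f : X ⟶ Y) (V : Y) (h : invIm f V = ⊤) :
    openLift f V h ≫ openIncl V = f :=
  hom_ext fun b => by simp [h]

/-- The inclusion between open sublocales given by `W ≤ U`. -/
def openInclLE {W U : X} (h : W ≤ U) : openSub W ⟶ openSub U :=
  openLift (openIncl W) U (val_injective (by simpa using h))

@[simp] theorem val_invIm_openInclLE {W U : X} (h : W ≤ U) (a : openSub U) :
    val (invIm (openInclLE h) a) = val a ⊓ W := rfl

@[simp] theorem openInclLE_comp {W U : X} (h : W ≤ U) :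
    openInclLE h ≫ openIncl U = openIncl W := openLift_comp _ _ _

theorem openIncl_isOpenRegularMono (U : X) : IsOpenRegularMono (openIncl U) := by
  refine ⟨isOpenMap_of_adjoint val ?_ ?_, ?_⟩
  · intro a b
    rw [← val_le_val, val_invIm_openIncl, le_inf_iff]
    exact ⟨fun h => ⟨h, val_le a⟩, fun h => h.1⟩
  · intro a b
    rw [val_inf, val_invIm_openIncl, ← inf_assoc, inf_eq_left]
    exact inf_le_left.trans (val_le a)
  · intro a
    exact ⟨val a, val_injective (by simpa using val_le a)⟩

/-- If the composite of a map with an open inclusion is an open regular monomorphism, so is the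
map. -/
theorem IsOpenRegularMono.of_comp_openIncl {V : Y} {f : X ⟶ openSub V}
    (h : IsOpenRegularMono (f ≫ openIncl V)) : IsOpenRegularMono f := by
  have key : ∀ v : openSub V, invIm f v = invIm (f ≫ openIncl V) (val v) := fun v => by
    rw [invIm_comp]
    congr 1
    exact val_injective (by simpa using (val_le v))
  have hV : ∀ a, dirIm (f ≫ openIncl V) a ≤ V := fun a => by
    rw [h.1.1]
    have := key ⊤
    rw [map_top, val_top] at this
    rw [← this]
    exact le_top
  refine ⟨isOpenMap_of_adjoint (fun a => mk (dirIm (f ≫ openIncl V) a) (hV a)) ?_ ?_, ?_⟩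
  · intro a v
    rw [← val_le_val, val_mk, h.1.1, key]
  · intro a v
    apply val_injective
    rw [val_inf, val_mk, val_mk, key, h.1.2]
  · intro a
    obtain ⟨b, rfl⟩ := h.2 a
    exact ⟨invIm (openIncl V) b, rfl⟩

theorem openInclLE_isOpenRegularMono {W U : X} (h : W ≤ U) : IsOpenRegularMono (openInclLE h) :=
  IsOpenRegularMono.of_comp_openIncl (by
    rw [openInclLE_comp]
    exact openIncl_isOpenRegularMono W)



theorem IsOpenRegularMono.dirIm_invIm {f : X ⟶ Y} (h : IsOpenRegularMono f) (b : Y) :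
    dirIm f (invIm f b) = dirIm f ⊤ ⊓ b := by
  rw [← h.1.2, top_inf_eq]

theorem IsOpenRegularMono.invIm_dirIm {f : X ⟶ Y} (h : IsOpenRegularMono f) (a : X) :
    invIm f (dirIm f a) = a := by
  obtain ⟨b, rfl⟩ := h.2 a
  rw [h.dirIm_invIm, map_inf]
  exact inf_eq_right.2 (le_top.trans (h.1.1.le_u_l ⊤))

/-- An open regular monomorphism `f : X ⟶ Y` is an isomorphism of `X` onto the open sublocale
of the image `f_!(⊤)`. This is the inverse isomorphism; its inverse image is `f_!`. -/
def invOnImage (f : X ⟶ Y) (h : IsOpenRegularMono f) : openSub (dirIm f ⊤) ⟶ X :=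
  ofInvIm
    { toFun := fun a => mk (dirIm f a) (h.1.1.monotone_l le_top)
      map_inf' := fun a b => val_injective (by
        rw [val_inf, val_mk, val_mk, val_mk]
        conv_lhs => rw [← h.invIm_dirIm b]
        rw [h.1.2])
      map_top' := rfl
      map_sSup' := fun s => val_injective (by
        rw [val_mk, val_sSup, Set.image_image, sSup_image, h.1.1.l_sSup]
        rfl) }

@[simp] theorem val_invIm_invOnImage {f : X ⟶ Y} (h : IsOpenRegularMono f) (a : X) :
    val (invIm (invOnImage f h) a) = dirIm f a := rfl

theorem invOnImage_comp {f : X ⟶ Y} (h : IsOpenRegularMono f) :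
    invOnImage f h ≫ f = openIncl (dirIm f ⊤) :=
  hom_ext fun b => val_injective (by
    rw [invIm_comp, val_invIm_invOnImage, h.dirIm_invIm, val_invIm_openIncl, inf_comm])

theorem invOnImage_isOpenRegularMono {f : X ⟶ Y} (h : IsOpenRegularMono f) :
    IsOpenRegularMono (invOnImage f h) := by
  have key : ∀ v : openSub (dirIm f ⊤), dirIm f (invIm f (val v)) = val v := fun v => by
    rw [h.dirIm_invIm]
    exact inf_eq_right.2 (val_le v)
  refine ⟨isOpenMap_of_adjoint (fun v => invIm f (val v)) ?_ ?_, ?_⟩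
  · intro v a
    rw [← val_le_val, val_invIm_invOnImage]
    constructor
    · intro hv
      rw [← key v]
      exact h.1.1.monotone_l hv
    · intro hv
      rw [← h.invIm_dirIm a]
      exact OrderHomClass.mono (invIm f) hv
  · intro v a
    rw [val_inf, map_inf, val_invIm_invOnImage, h.invIm_dirIm]
  · intro v
    exact ⟨invIm f (val v), val_injective (key v)⟩

/-- A map of locales is a local homeomorphism when its domain is covered by open sublocales on
which the map restricts to an open embedding. -/
def IsLocalHomeo (f : X ⟶ Y) : Prop :=
  ∃ C : Set X, sSup C = ⊤ ∧ ∀ c ∈ C, IsOpenRegularMono (openIncl c ≫ f)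

end Locale

/-! ## Localic groupoids and their functors -/

/-- The structure of an internal groupoid in the category of locales with locale of objects `G₀`
and locale of arrows `G₁`: domain `d`, range `r`, units `u`, inversion `i`, a pullback `G₂` of `r`
and `d` (the locale of pairs `(x, y)` with `r(x) = d(y)`), and multiplication `m : G₂ ⟶ G₁`. The
laws involving several arrows are stated for generalized elements. -/
structure GroupoidStr (G₀ G₁ : Locale.{u}) where
  G₂ : Locale.{u}
  d : G₁ ⟶ G₀
  r : G₁ ⟶ G₀
  u : G₀ ⟶ G₁
  i : G₁ ⟶ G₁
  π₁ : G₂ ⟶ G₁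
  π₂ : G₂ ⟶ G₁
  isPullback : IsPullback π₁ π₂ r d
  m : G₂ ⟶ G₁
  m_d : m ≫ d = π₁ ≫ d
  m_r : m ≫ r = π₂ ≫ r
  u_d : u ≫ d = 𝟙 G₀
  u_r : u ≫ r = 𝟙 G₀
  i_d : i ≫ d = r
  i_r : i ≫ r = d
  unit_left : isPullback.lift (d ≫ u) (𝟙 G₁) (by simp [u_r]) ≫ m = 𝟙 G₁
  unit_right : isPullback.lift (𝟙 G₁) (r ≫ u) (by simp [u_d]) ≫ m = 𝟙 G₁
  inv_right : isPullback.lift (𝟙 G₁) i (by simp [i_d]) ≫ m = d ≫ u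
  inv_left : isPullback.lift i (𝟙 G₁) (by simp [i_r]) ≫ m = r ≫ u
  assoc : ∀ {X : Locale.{u}} (x y z : X ⟶ G₁) (hxy : x ≫ r = y ≫ d) (hyz : y ≫ r = z ≫ d),
    isPullback.lift (isPullback.lift x y hxy ≫ m) z (by simp [m_r, hyz]) ≫ m =
      isPullback.lift x (isPullback.lift y z hyz ≫ m) (by simp [m_d, hxy]) ≫ m

/-- A localic groupoid: an internal groupoid in the category of locales. -/
structure LocalicGroupoid where
  G₀ : Locale.{u}
  G₁ : Locale.{u}
  str : GroupoidStr G₀ G₁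

namespace LocalicGroupoid

open Locale

/-- The product `x y : X ⟶ G₁` of two composable generalized elements of `G₁`. -/
def comp (G : LocalicGroupoid.{u}) {X : Locale.{u}} (x y : X ⟶ G.G₁)
    (h : x ≫ G.str.r = y ≫ G.str.d) : X ⟶ G.G₁ :=
  G.str.isPullback.lift x y h ≫ G.str.m

/-- Functors of localic groupoids (internal functors). -/
@[ext]
structure Hom (G H : LocalicGroupoid.{u}) where
  f₀ : G.G₀ ⟶ H.G₀
  f₁ : G.G₁ ⟶ H.G₁
  comm_d : G.str.d ≫ f₀ = f₁ ≫ H.str.d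
  comm_r : G.str.r ≫ f₀ = f₁ ≫ H.str.r
  comm_u : G.str.u ≫ f₁ = f₀ ≫ H.str.u
  comm_m : G.str.m ≫ f₁ = H.comp (G.str.π₁ ≫ f₁) (G.str.π₂ ≫ f₁) (by
    rw [Category.assoc, Category.assoc, ← comm_d, ← comm_r, reassoc_of% G.str.isPullback.w])

theorem Hom.map_comp {G H : LocalicGroupoid.{u}} (F : Hom G H) {X : Locale.{u}}
    (x y : X ⟶ G.G₁) (h : x ≫ G.str.r = y ≫ G.str.d)
    (h' : (x ≫ F.f₁) ≫ H.str.r = (y ≫ F.f₁) ≫ H.str.d) :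
    G.comp x y h ≫ F.f₁ = H.comp (x ≫ F.f₁) (y ≫ F.f₁) h' := by
  rw [comp, Category.assoc, F.comm_m, comp, comp, ← Category.assoc]
  congr 1
  apply H.str.isPullback.hom_ext <;> simp

instance : Category LocalicGroupoid.{u} where
  Hom := Hom
  id G :=
    { f₀ := 𝟙 _
      f₁ := 𝟙 _
      comm_d := by simp
      comm_r := by simp
      comm_u := by simp
      comm_m := by
        rw [Category.comp_id, comp]
        conv_lhs => rw [← Category.id_comp G.str.m]
        congr 1
        apply G.str.isPullback.hom_ext <;> simp }
  comp {G H K} F F' :=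
    { f₀ := F.f₀ ≫ F'.f₀
      f₁ := F.f₁ ≫ F'.f₁
      comm_d := by rw [reassoc_of% F.comm_d, F'.comm_d, Category.assoc]
      comm_r := by rw [reassoc_of% F.comm_r, F'.comm_r, Category.assoc]
      comm_u := by rw [reassoc_of% F.comm_u, F'.comm_u, Category.assoc]
      comm_m := by
        rw [reassoc_of% F.comm_m, F'.map_comp]
        · simp
        · simp only [Category.assoc]
          rw [← F'.comm_r, ← F'.comm_d, ← reassoc_of% F.comm_r, ← reassoc_of% F.comm_d,
            reassoc_of% G.str.isPullback.w] }
  id_comp F := Hom.ext (Category.id_comp _) (Category.id_comp _)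
  comp_id F := Hom.ext (Category.comp_id _) (Category.comp_id _)
  assoc F F' F'' := Hom.ext (Category.assoc _ _ _) (Category.assoc _ _ _)

/-- A localic groupoid is open when its domain map is open. -/
def IsOpen (G : LocalicGroupoid.{u}) : Prop := IsOpenMap G.str.d

/-- A localic groupoid is étale when its domain map is a local homeomorphism. -/
def IsEtale (G : LocalicGroupoid.{u}) : Prop := IsLocalHomeo G.str.d

/-! ## The quantale of an open groupoid -/

variable (G : LocalicGroupoid.{u})

/-- The multiplication of the quantale `𝒪(G)`, whose underlying frame is that of `G₁`: the
composite of `a ⊗ b ↦ π₁^*(a) ⊓ π₂^*(b)` with the direct image of the multiplication of `G`. -/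
def qmul (a b : G.G₁) : G.G₁ :=
  dirIm G.str.m (invIm G.str.π₁ a ⊓ invIm G.str.π₂ b)

/-- The involution `a^*` of the quantale `𝒪(G)`. -/
def qstar (a : G.G₁) : G.G₁ := invIm G.str.i a

/-! ## Local bisections -/

/-- A local bisection of `G`: a section `s` of `d` on the open sublocale of an open `U` of `G₀`
such that `r ∘ s` is an open regular monomorphism. -/
@[ext]
structure LocalBisection where
  U : G.G₀
  s : openSub U ⟶ G.G₁
  s_d : s ≫ G.str.d = openIncl U
  s_r : IsOpenRegularMono (s ≫ G.str.r)

variable {G}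

namespace LocalBisection

/-- The restriction of a local bisection to a smaller domain. -/
def restrict (σ : G.LocalBisection) (W : G.G₀) (h : W ≤ σ.U) : G.LocalBisection where
  U := W
  s := openInclLE h ≫ σ.s
  s_d := by rw [Category.assoc, σ.s_d, openInclLE_comp]
  s_r := by
    rw [Category.assoc]
    exact (openInclLE_isOpenRegularMono h).comp σ.s_r

/-- Local bisections are ordered by restriction. -/
instance : LE G.LocalBisection where
  le σ τ := ∃ h : σ.U ≤ τ.U, openInclLE h ≫ τ.s = σ.s

theorem le_iff {σ τ : G.LocalBisection} :
    σ ≤ τ ↔ σ.U ≤ τ.U ∧ ∀ a, val (invIm σ.s a) = val (invIm τ.s a) ⊓ σ.U := by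
  constructor
  · rintro ⟨h, h'⟩
    refine ⟨h, fun a => ?_⟩
    rw [← h']
    rfl
  · rintro ⟨h, h'⟩
    exact ⟨h, hom_ext fun a => val_injective (h' a).symm⟩

instance : PartialOrder G.LocalBisection where
  le_refl σ := le_iff.2 ⟨le_rfl, fun a => (inf_eq_left.2 (val_le _)).symm⟩
  le_trans σ τ ρ h h' := by
    rw [le_iff] at *
    refine ⟨h.1.trans h'.1, fun a => ?_⟩
    rw [h.2, h'.2, inf_assoc, inf_eq_right.2 h.1]
  le_antisymm σ τ h h' := by
    rw [le_iff] at h h'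
    obtain ⟨U, s, hs, hs'⟩ := σ
    obtain ⟨V, t, ht, ht'⟩ := τ
    obtain rfl : U = V := le_antisymm h.1 h'.1
    congr 1
    refine hom_ext fun a => val_injective ?_
    have := h.2 a
    simp only at this
    rw [this]
    exact inf_eq_left.2 (val_le _)

theorem restrict_le (σ : G.LocalBisection) (W : G.G₀) (h : W ≤ σ.U) : σ.restrict W h ≤ σ :=
  ⟨h, rfl⟩

/-- The global bisection `ε = (1, u)` of units. -/
def unit (G : LocalicGroupoid.{u}) : G.LocalBisection where
  U := ⊤
  s := openIncl ⊤ ≫ G.str.u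
  s_d := by rw [Category.assoc, G.str.u_d, Category.comp_id]
  s_r := by
    rw [Category.assoc, G.str.u_r, Category.comp_id]
    exact openIncl_isOpenRegularMono _

/-- The codomain `V` of a local bisection, that is, the image of `r ∘ s`. -/
abbrev V (σ : G.LocalBisection) : G.G₀ := dirIm (σ.s ≫ G.str.r) ⊤

/-- The codomain section `t = s ∘ α⁻¹` of a local bisection, where `α` is the isomorphism of the
open sublocale of `U` onto that of `V` given by `r ∘ s`. -/
def t (σ : G.LocalBisection) : openSub σ.V ⟶ G.G₁ := invOnImage (σ.s ≫ G.str.r) σ.s_r ≫ σ.s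

/-- The inverse `(V, i ∘ t)` of a local bisection. -/
def inverse (σ : G.LocalBisection) : G.LocalBisection where
  U := σ.V
  s := σ.t ≫ G.str.i
  s_d := by
    rw [Category.assoc, G.str.i_d]
    exact invOnImage_comp σ.s_r
  s_r := by
    have h : σ.t ≫ G.str.d = invOnImage (σ.s ≫ G.str.r) σ.s_r ≫ openIncl σ.U := by
      rw [← σ.s_d]
      rfl
    rw [Category.assoc, G.str.i_r, h]
    exact (invOnImage_isOpenRegularMono σ.s_r).comp (openIncl_isOpenRegularMono _)

/-- The domain of the product `σ τ`, namely `s_σ^*(r^*(U_τ))`. -/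
def mulDom (σ τ : G.LocalBisection) : G.G₀ := val (invIm σ.s (invIm G.str.r τ.U))

/-- The map `β` from the domain of `σ τ` to the domain of `τ` given by restricting `r ∘ s_σ`. -/
def mulMap (σ τ : G.LocalBisection) : openSub (mulDom σ τ) ⟶ openSub τ.U :=
  openLift (openInclLE (val_le _ : mulDom σ τ ≤ σ.U) ≫ σ.s ≫ G.str.r) τ.U
    (val_injective (inf_idem _))

theorem mulMap_comp (σ τ : G.LocalBisection) : mulMap σ τ ≫ openIncl τ.U =
    openInclLE (val_le _ : mulDom σ τ ≤ σ.U) ≫ σ.s ≫ G.str.r :=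
  openLift_comp _ _ _

theorem mulMap_isOpenRegularMono (σ τ : G.LocalBisection) : IsOpenRegularMono (mulMap σ τ) :=
  IsOpenRegularMono.of_comp_openIncl (by
    rw [mulMap_comp]
    exact (openInclLE_isOpenRegularMono _).comp σ.s_r)

/-- The product of local bisections: `s_{σ τ} = m ∘ ⟨s_σ ∘ ι, s_τ ∘ β⟩` on the domain
`s_σ^*(r^*(U_τ))`, where `ι` is the inclusion of this domain into `U_σ`. -/
instance : Mul G.LocalBisection where
  mul σ τ :=
    { U := mulDom σ τ
      s := G.comp (openInclLE (val_le _ : mulDom σ τ ≤ σ.U) ≫ σ.s) (mulMap σ τ ≫ τ.s) (by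
        rw [Category.assoc, Category.assoc, τ.s_d]
        exact (mulMap_comp σ τ).symm)
      s_d := by
        rw [comp, Category.assoc, G.str.m_d, IsPullback.lift_fst_assoc, Category.assoc, σ.s_d]
        exact openInclLE_comp _
      s_r := by
        rw [comp, Category.assoc, G.str.m_r, IsPullback.lift_snd_assoc, Category.assoc]
        exact (mulMap_isOpenRegularMono σ τ).comp τ.s_r }

/-- The action of a local bisection on the quantale of `G`:
`σ · a = ⋁ {s^*(x) ⊓ y | x^* y ≤ a}`, opens of `G₀` being regarded as right-sided elements of the
quantale through `d^*`. -/
def act (σ : G.LocalBisection) (a : G.G₁) : G.G₁ :=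
  sSup {c | ∃ x y : G.G₁, G.qmul (G.qstar x) y ≤ a ∧
    c = invIm G.str.d (val (invIm σ.s x)) ⊓ y}

theorem le_sSup_of_isLUB {X : Set G.LocalBisection} {σ : G.LocalBisection} (h : IsLUB X σ) :
    σ.U ≤ sSup (U '' X) := by
  have hW : sSup (U '' X) ≤ σ.U := sSup_le (by
    rintro _ ⟨ρ, hρ, rfl⟩
    exact (le_iff.1 (h.1 hρ)).1)
  refine (le_iff.1 (h.2 (show σ.restrict _ hW ∈ upperBounds X from fun ρ hρ => ?_))).1
  refine le_iff.2 ⟨le_sSup ⟨ρ, hρ, rfl⟩, fun a => ?_⟩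
  have h1 : val (invIm (σ.restrict _ hW).s a) = val (invIm σ.s a) ⊓ sSup (U '' X) := rfl
  have h2 : ρ.U ≤ sSup (U '' X) := le_sSup ⟨ρ, hρ, rfl⟩
  rw [h1, (le_iff.1 (h.1 hρ)).2, inf_assoc, inf_eq_right.2 h2]

theorem isLUB_of_le_sSup {X : Set G.LocalBisection} {σ : G.LocalBisection}
    (h : ∀ ρ ∈ X, ρ ≤ σ) (h' : σ.U ≤ sSup (U '' X)) : IsLUB X σ := by
  refine ⟨h, fun τ hτ => le_iff.2 ⟨h'.trans (sSup_le ?_), fun a => ?_⟩⟩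
  · rintro _ ⟨ρ, hρ, rfl⟩
    exact (le_iff.1 (hτ hρ)).1
  · have e2 : σ.U = sSup (U '' X) := h'.antisymm (sSup_le (by
      rintro _ ⟨ρ, hρ, rfl⟩
      exact (le_iff.1 (h ρ hρ)).1))
    have e3 : ∀ b : G.G₀, b ⊓ σ.U = ⨆ ρ ∈ X, b ⊓ ρ.U := fun b => by
      rw [e2, inf_sSup_eq, iSup_image]
    have e1 : val (invIm σ.s a) = val (invIm σ.s a) ⊓ σ.U := (inf_eq_left.2 (val_le _)).symm
    rw [e1, e3, e3]
    refine iSup_congr fun ρ => iSup_congr fun hρ => ?_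
    rw [← (le_iff.1 (h ρ hρ)).2, (le_iff.1 (hτ hρ)).2]

end LocalBisection

/-! ## The quantale completion of the inverse semigroup of local bisections -/

variable (G) in
/-- The elements of the completion: sets of local bisections that are downwards closed and closed
under joins of compatible subsets. (A set of local bisections is compatible if and only if it has
a join in the restriction order.) -/
@[ext]
structure Completion where
  carrier : Set G.LocalBisection
  lower : ∀ ⦃σ τ : G.LocalBisection⦄, τ ≤ σ → σ ∈ carrier → τ ∈ carrier
  closed : ∀ (X : Set G.LocalBisection) (σ : G.LocalBisection),
    X ⊆ carrier → IsLUB X σ → σ ∈ carrier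

namespace Completion

open LocalBisection

instance : SetLike G.Completion G.LocalBisection where
  coe := carrier
  coe_injective _ _ h := Completion.ext h

/-- The completion is ordered by inclusion. -/
instance : PartialOrder G.Completion := PartialOrder.ofSetLike _ _

instance : InfSet G.Completion where
  sInf A :=
    { carrier := {σ | ∀ a ∈ A, σ ∈ a}
      lower := fun _ _ h hσ a ha => a.lower h (hσ a ha)
      closed := fun X σ hX hσ a ha => a.closed X σ (fun _ hρ => hX hρ a ha) hσ }

theorem mem_sInf {A : Set G.Completion} {σ : G.LocalBisection} :
    σ ∈ sInf A ↔ ∀ a ∈ A, σ ∈ a := Iff.rfl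

instance : CompleteLattice G.Completion :=
  completeLatticeOfInf _ fun _ =>
    ⟨fun a ha _ hσ => hσ a ha, fun _ hb _ hσ _ ha => hb ha hσ⟩

/-- The relative pseudocomplement in the completion. -/
def imp (a b : G.Completion) : G.Completion where
  carrier := {σ | ∀ τ ≤ σ, τ ∈ a → τ ∈ b}
  lower := fun _ _ h hσ ρ hρ => hσ ρ (hρ.trans h)
  closed := by
    intro X σ hX hσ τ hτ hτa
    have hle : ∀ ρ : G.LocalBisection, τ.U ⊓ ρ.U ≤ τ.U := fun ρ => inf_le_left
    refine b.closed ((fun ρ => τ.restrict (τ.U ⊓ ρ.U) (hle ρ)) '' X) τ ?_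
      (isLUB_of_le_sSup ?_ ?_)
    · rintro _ ⟨ρ, hρ, rfl⟩
      refine hX hρ _ ?_ (a.lower (τ.restrict_le _ (hle ρ)) hτa)
      have hρσ := le_iff.1 (hσ.1 hρ)
      have hτσ := le_iff.1 hτ
      refine le_iff.2 ⟨inf_le_right, fun c => ?_⟩
      have e : val (invIm (τ.restrict (τ.U ⊓ ρ.U) (hle ρ)).s c) =
        val (invIm τ.s c) ⊓ (τ.U ⊓ ρ.U) := rfl
      have e' : (τ.restrict (τ.U ⊓ ρ.U) (hle ρ)).U = τ.U ⊓ ρ.U := rfl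
      rw [e, e', hτσ.2, hρσ.2, inf_assoc, inf_assoc, ← inf_assoc τ.U τ.U, inf_idem,
        ← inf_assoc ρ.U, inf_comm ρ.U τ.U, inf_assoc τ.U, inf_idem]
    · rintro _ ⟨ρ, hρ, rfl⟩
      exact τ.restrict_le _ (hle ρ)
    · have h1 : τ.U ≤ τ.U ⊓ sSup (U '' X) :=
        le_inf le_rfl ((le_iff.1 hτ).1.trans (le_sSup_of_isLUB hσ))
      refine h1.trans ?_
      rw [inf_sSup_eq]
      refine iSup₂_le ?_
      rintro _ ⟨ρ, hρ, rfl⟩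
      exact le_sSup ⟨_, ⟨ρ, hρ, rfl⟩, rfl⟩

/-- The completion is a frame. -/
instance : Order.Frame G.Completion :=
  Order.Frame.ofMinimalAxioms
    { inf_sSup_le_iSup_inf := by
        intro a s
        have h : sSup s ≤ imp a (⨆ b ∈ s, a ⊓ b) := by
          refine sSup_le fun b hb σ hσ τ hτ hτa => ?_
          have h1 : a ⊓ b ≤ ⨆ b ∈ s, a ⊓ b := le_iSup₂ (f := fun b (_ : b ∈ s) => a ⊓ b) b hb
          refine h1 ?_
          intro c hc
          rcases hc with rfl | rfl
          · exact hτa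
          · exact c.lower hτ hσ
        intro σ hσ
        have h1 : σ ∈ a := (inf_le_left : a ⊓ sSup s ≤ a) hσ
        have h2 : σ ∈ sSup s := (inf_le_right : a ⊓ sSup s ≤ sSup s) hσ
        exact h h2 σ le_rfl h1 }

/-- The principal element `σ̂ = {τ | τ ≤ σ}`. -/
def hat (σ : G.LocalBisection) : G.Completion where
  carrier := {τ | τ ≤ σ}
  lower := fun _ _ h h' => h.trans h'
  closed := fun _ _ hX hσ => hσ.2 hX

/-- The product of two elements of the completion is generated by the products of their members. -/
instance : Mul G.Completion where
  mul a b := sInf {c | ∀ σ ∈ a, ∀ τ ∈ b, σ * τ ∈ c}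

/-- The involution of the completion is generated by the inverses of the members. -/
instance : Star G.Completion where
  star a := sInf {c | ∀ σ ∈ a, σ.inverse ∈ c}

/-- The multiplicative unit of the completion is `ε̂`; its members are the restrictions of `ε`,
which are the idempotent local bisections. -/
instance : One G.Completion where
  one := hat (LocalBisection.unit G)

end Completion

/-- The map `j` from the quantale of `G` to the completion: `j(a)` is the set of local bisections
`σ` such that `s^*(a) = U`. -/
def j (a : G.G₁) : G.Completion where
  carrier := {σ | val (invIm σ.s a) = σ.U}
  lower := by
    intro σ τ h hσ
    rw [LocalBisection.le_iff] at h
    show val (invIm τ.s a) = τ.U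
    rw [h.2, show val (invIm σ.s a) = σ.U from hσ, inf_eq_right.2 h.1]
  closed := by
    intro X σ hX hσ
    refine (val_le _).antisymm ((LocalBisection.le_sSup_of_isLUB hσ).trans (sSup_le ?_))
    rintro _ ⟨ρ, hρ, rfl⟩
    have h1 : val (invIm ρ.s a) = ρ.U := hX hρ
    rw [← h1, (LocalBisection.le_iff.1 (hσ.1 hρ)).2]
    exact inf_le_left

variable (G)

/-- `G` is weakly coverable when its quantale is weakly embeddable: `σ̂ j(a) = j(σ · a)`. -/
def IsWeaklyCoverable : Prop :=
  ∀ (σ : G.LocalBisection) (a : G.G₁), Completion.hat σ * j a = j (σ.act a)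

/-- `G` has enough bisections when `j` is a monomorphism. -/
def HasEnoughBisections : Prop := Function.Injective (j : G.G₁ → G.Completion)

end LocalicGroupoid

open Locale in
/-- Let `Q` be a unital involutive quantal frame with multiplicative unit `1` and top element `⊤`.
A groupoid structure with `𝒪(G₀) = ↓1` and `𝒪(G₁) = Q` is the groupoid `𝒢(Q)` of `Q` when
`d^*(b) = b ⊤`, `r^*(b) = ⊤ b`, `u^*(a) = a ⊓ 1`, `i^*(a) = a^*` and
`m^*(a) = ⋁ {x ⊗ y | x y ≤ a}`, that is, `m^*` is right adjoint to the multiplication of `Q`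
reduced to the frame of `G₂`. -/
structure IsGroupoidOfQuantale {Q : Type u} [Order.Frame Q] [Mul Q] [Star Q] [One Q]
    (S : GroupoidStr (openSub (X := Locale.of Q) (1 : Q)) (Locale.of Q)) : Prop where
  d_eq : ∀ (b : Q) (hb : b ≤ 1), invIm S.d (mk (X := Locale.of Q) b hb) = (b * ⊤ : Q)
  r_eq : ∀ (b : Q) (hb : b ≤ 1), invIm S.r (mk (X := Locale.of Q) b hb) = (⊤ * b : Q)
  u_eq : ∀ a : Q, val (invIm S.u a) = (a ⊓ 1 : Q)
  i_eq : ∀ a : Q, invIm S.i a = (star a : Q)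
  m_eq : ∀ a : Q, invIm S.m a =
    sSup {c | ∃ x y : Q, x * y ≤ a ∧ c = invIm S.π₁ x ⊓ invIm S.π₂ y}

end

/-!
The locale of arrows of `𝒢(Q̂)` is the locale of germs of local bisections: a map `x` into it is
determined by the opens `x^*(σ̂)` on which `x` is a germ of `σ`, and the open sublocale `σ̂` is a copy
of the domain of `σ` (`chart`). The comparison map `germMap`, with inverse image `j`, restricts
on this chart to the section `s_σ`; equivalently `j(a) ⊓ σ̂` is the principal element of the part of
`σ` that lies in `a` (`j_inf_hat`). The domain and range of a germ are therefore those of its image in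
`G`, and only the multiplication has to be constructed.

Local bisections are handled through their generalized elements: `σ.Contains x` says that
`x : X ⟶ G₁` factors through `s_σ`. The order is inclusion of subobjects (`le_iff_contains`), the
elements of `σ τ` are the products of elements of `σ` and `τ`, and those of `σ⁻¹` are the inverses.
The laws of the inverse semigroup then follow from the groupoid laws of `G` without computing domains.

The product of composable maps `x`, `y` into the locale of germs has the inverse image
`A ↦ ⋁ {x^*(σ̂) ⊓ y^*(τ̂) | σ τ ∈ A}` (`germMul`). This is a homomorphism of frames by the universal
property of the completion (`Completion.extend`): preservation of joins holds because composability
allows `σ` to be cut down to the domain of `σ τ` (`Composable.pull_inf_le`). The groupoid laws reduce to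
the laws of the inverse semigroup, and `germMap` is multiplicative because both sides agree on each
open `x^*(σ̂) ⊓ y^*(τ̂)` (`Composable.pull_inf_invIm_comp`). The object of composable pairs is the fibre
product of locales, constructed from the sets of open rectangles contained in an open (`FiberProd`).

The charts show that the groupoid of germs is étale. The functor to `G` is an isomorphism on objects
and its inverse image `j` on arrows is injective, so that the functor is an epimorphism. If `G` is étale, every local
bisection is an open embedding, so that every `σ̂` is some `j(a)` and `j` is also surjective; conversely
an isomorphism transports the étale property.
-/

noncomputable section

namespace Locale

variable {X Y Z B : Locale.{u}}

/-! ### Maps into the locale of a frame -/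

/-- The inverse image of a map into the locale of a frame `Q`, as a homomorphism defined on `Q`
itself. -/
def pull {Q : Type u} [Order.Frame Q] (x : X ⟶ Locale.of Q) : FrameHom Q X := invIm x

theorem pull_comp {Q : Type u} [Order.Frame Q] (f : X ⟶ Y) (x : Y ⟶ Locale.of Q) (a : Q) :
    pull (f ≫ x) a = invIm f (pull x a) := rfl

/-! ### Fibre products of locales -/

/-- The opens of the fibre product of `f : Y ⟶ B` and `g : Z ⟶ B`. Such an open is represented by
the set of all pairs `(a, b)` whose open rectangle `a × b` it contains: a lower set that is closed
under joins in each variable and that does not distinguish `(a ⊓ f^*(c), b)` from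
`(a, b ⊓ g^*(c))`. -/
@[ext]
structure FiberProd (f : Y ⟶ B) (g : Z ⟶ B) where
  carrier : Set (Y × Z)
  lower : ∀ ⦃p q : Y × Z⦄, q ≤ p → p ∈ carrier → q ∈ carrier
  sSup_left : ∀ (s : Set Y) (b : Z), (∀ a ∈ s, (a, b) ∈ carrier) → (sSup s, b) ∈ carrier
  sSup_right : ∀ (a : Y) (s : Set Z), (∀ b ∈ s, (a, b) ∈ carrier) → (a, sSup s) ∈ carrier
  balanced : ∀ (a : Y) (b : Z) (c : B),
    (a ⊓ invIm f c, b) ∈ carrier ↔ (a, b ⊓ invIm g c) ∈ carrier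

namespace FiberProd

variable {f : Y ⟶ B} {g : Z ⟶ B}

instance : SetLike (FiberProd f g) (Y × Z) where
  coe := carrier
  coe_injective _ _ h := FiberProd.ext h

instance : PartialOrder (FiberProd f g) := PartialOrder.ofSetLike _ _

instance : InfSet (FiberProd f g) where
  sInf A :=
    { carrier := {p | ∀ R ∈ A, p ∈ R}
      lower := fun _ _ h hp R hR => R.lower h (hp R hR)
      sSup_left := fun s b h R hR => R.sSup_left s b fun a ha => h a ha R hR
      sSup_right := fun a s h R hR => R.sSup_right a s fun b hb => h b hb R hR
      balanced := fun a b c => forall₂_congr fun R _ => R.balanced a b c }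

instance : CompleteLattice (FiberProd f g) :=
  completeLatticeOfInf _ fun _ =>
    ⟨fun R hR _ hp => hp R hR, fun _ hS _ hp _ hR => hS hR hp⟩

theorem mem_sInf {A : Set (FiberProd f g)} {p : Y × Z} : p ∈ sInf A ↔ ∀ R ∈ A, p ∈ R := Iff.rfl

theorem mem_inf {R S : FiberProd f g} {p : Y × Z} : p ∈ R ⊓ S ↔ p ∈ R ∧ p ∈ S := by
  rw [← sInf_pair, mem_sInf]
  simp

/-- The pairs whose meet with `p` belongs to `R`. -/
def residual (p : Y × Z) (R : FiberProd f g) : FiberProd f g where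
  carrier := {q | p ⊓ q ∈ R}
  lower := fun _ _ h hq => R.lower (inf_le_inf_left p h) hq
  sSup_left := fun s b h => by
    have e : p ⊓ (sSup s, b) = (sSup ((p.1 ⊓ ·) '' s), p.2 ⊓ b) :=
      Prod.ext (by rw [Prod.fst_inf, inf_sSup_eq, sSup_image]) rfl
    rw [Set.mem_ofPred_eq, e]
    refine R.sSup_left _ _ ?_
    rintro _ ⟨a, ha, rfl⟩
    exact h a ha
  sSup_right := fun a s h => by
    have e : p ⊓ (a, sSup s) = (p.1 ⊓ a, sSup ((p.2 ⊓ ·) '' s)) :=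
      Prod.ext rfl (by rw [Prod.snd_inf, inf_sSup_eq, sSup_image])
    rw [Set.mem_ofPred_eq, e]
    refine R.sSup_right _ _ ?_
    rintro _ ⟨b, hb, rfl⟩
    exact h b hb
  balanced := fun a b c => by
    have e : p ⊓ (a ⊓ invIm f c, b) = ((p.1 ⊓ a) ⊓ invIm f c, p.2 ⊓ b) :=
      Prod.ext (inf_assoc _ _ _).symm rfl
    have e' : p ⊓ (a, b ⊓ invIm g c) = (p.1 ⊓ a, (p.2 ⊓ b) ⊓ invIm g c) :=
      Prod.ext rfl (inf_assoc _ _ _).symm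
    rw [Set.mem_ofPred_eq, Set.mem_ofPred_eq, e, e']
    exact R.balanced _ _ _

theorem mem_residual {p q : Y × Z} {R : FiberProd f g} : q ∈ residual p R ↔ p ⊓ q ∈ R := Iff.rfl

instance : Order.Frame (FiberProd f g) :=
  Order.Frame.ofMinimalAxioms
    { inf_sSup_le_iSup_inf := by
        intro R A p hp
        rw [mem_inf] at hp
        have h : sSup A ≤ residual p (⨆ S ∈ A, R ⊓ S) := sSup_le fun S hS q hq =>
          (le_iSup₂ (f := fun S (_ : S ∈ A) => R ⊓ S) S hS)
            (mem_inf.2 ⟨R.lower inf_le_left hp.1, S.lower inf_le_right hq⟩)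
        simpa using mem_residual.1 (h hp.2) }

/-- The open rectangle `a × b`. -/
def rect (a : Y) (b : Z) : FiberProd f g := sInf {R | (a, b) ∈ R}

theorem rect_le {a : Y} {b : Z} {R : FiberProd f g} : rect a b ≤ R ↔ (a, b) ∈ R :=
  ⟨fun h => h fun _ hS => hS, fun h => sInf_le h⟩

theorem mem_rect (a : Y) (b : Z) : (a, b) ∈ (rect a b : FiberProd f g) := rect_le.1 le_rfl

theorem rect_mono {a a' : Y} {b b' : Z} (h : a ≤ a') (h' : b ≤ b') :
    (rect a b : FiberProd f g) ≤ rect a' b' :=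
  rect_le.2 ((rect a' b').lower (show ((a, b) : Y × Z) ≤ (a', b') from ⟨h, h'⟩) (mem_rect a' b'))

theorem rect_inf (a a' : Y) (b b' : Z) :
    (rect (a ⊓ a') (b ⊓ b') : FiberProd f g) = rect a b ⊓ rect a' b' := by
  refine le_antisymm (le_inf (rect_mono inf_le_left inf_le_left)
    (rect_mono inf_le_right inf_le_right)) fun q hq => ?_
  rw [mem_inf] at hq
  have h : ∀ p ∈ (rect a b : FiberProd f g),
      (a', b') ⊓ p ∈ (rect (a ⊓ a') (b ⊓ b') : FiberProd f g) := fun p hp => by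
    have h : rect a b ≤ residual (a', b') (rect (a ⊓ a') (b ⊓ b') : FiberProd f g) :=
      rect_le.2 (mem_residual.2 (by
        rw [inf_comm (a', b') (a, b)]
        exact mem_rect (f := f) (g := g) (a ⊓ a') (b ⊓ b')))
    exact h hp
  have h' : rect a' b' ≤ residual q (rect (a ⊓ a') (b ⊓ b') : FiberProd f g) :=
    rect_le.2 (mem_residual.2 (by
      rw [inf_comm q (a', b')]
      exact h q hq.1))
  simpa using mem_residual.1 (h' hq.2)

theorem rect_top : (rect ⊤ ⊤ : FiberProd f g) = ⊤ :=
  top_le_iff.1 fun p _ => (rect ⊤ ⊤).lower (show p ≤ (⊤, ⊤) from le_top) (mem_rect ⊤ ⊤)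

/-- The first projection of the fibre product, with inverse image `a ↦ a × Z`. -/
def fst (f : Y ⟶ B) (g : Z ⟶ B) : Locale.of (FiberProd f g) ⟶ Y :=
  let φ : FrameHom Y (FiberProd f g) :=
    { toFun := fun a => rect a ⊤
      map_inf' := fun a b => by rw [← rect_inf, inf_idem]
      map_top' := rect_top
      map_sSup' := fun s => by
        refine le_antisymm (rect_le.2 (FiberProd.sSup_left _ _ _ fun a ha => rect_le.1 ?_))
          (sSup_le ?_)
        · exact le_sSup (Set.mem_image_of_mem _ ha)
        · rintro _ ⟨a, ha, rfl⟩
          exact rect_mono (le_sSup ha) le_rfl }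
  ofInvIm φ

/-- The second projection of the fibre product, with inverse image `b ↦ Y × b`. -/
def snd (f : Y ⟶ B) (g : Z ⟶ B) : Locale.of (FiberProd f g) ⟶ Z :=
  let φ : FrameHom Z (FiberProd f g) :=
    { toFun := fun b => rect ⊤ b
      map_inf' := fun a b => by rw [← rect_inf, inf_idem]
      map_top' := rect_top
      map_sSup' := fun s => by
        refine le_antisymm (rect_le.2 (FiberProd.sSup_right _ _ _ fun b hb => rect_le.1 ?_))
          (sSup_le ?_)
        · exact le_sSup (Set.mem_image_of_mem _ hb)
        · rintro _ ⟨b, hb, rfl⟩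
          exact rect_mono le_rfl (le_sSup hb) }
  ofInvIm φ

theorem rect_eq_inf (a : Y) (b : Z) : (rect a b : FiberProd f g) = rect a ⊤ ⊓ rect ⊤ b := by
  have h := rect_inf (f := f) (g := g) a ⊤ ⊤ b
  rwa [inf_top_eq, top_inf_eq] at h

theorem condition (f : Y ⟶ B) (g : Z ⟶ B) : fst f g ≫ f = snd f g ≫ g := by
  refine hom_ext fun c => ?_
  have h : ∀ R : FiberProd f g, (invIm f c, ⊤) ∈ R ↔ (⊤, invIm g c) ∈ R := fun R => by
    have h := R.balanced ⊤ ⊤ c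
    rwa [top_inf_eq, top_inf_eq] at h
  exact le_antisymm (rect_le.2 ((h _).2 (mem_rect _ _))) (rect_le.2 ((h _).1 (mem_rect _ _)))

theorem eq_sSup_rect (R : FiberProd f g) :
    R = sSup {S | ∃ a b, (a, b) ∈ R ∧ S = rect a b} := by
  refine le_antisymm (fun p hp => ?_) (sSup_le ?_)
  · exact rect_le.1 (le_sSup ⟨p.1, p.2, hp, rfl⟩)
  · rintro _ ⟨a, b, h, rfl⟩
    exact rect_le.2 h

theorem hom_ext {x y : X ⟶ Locale.of (FiberProd f g)} (h₁ : x ≫ fst f g = y ≫ fst f g)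
    (h₂ : x ≫ snd f g = y ≫ snd f g) : x = y := by
  have key : ∀ a b, pull x (rect a b : FiberProd f g) = pull y (rect a b : FiberProd f g) :=
    fun a b => by
      rw [rect_eq_inf, map_inf, map_inf]
      exact congrArg₂ (· ⊓ ·) (congrArg (invIm · a) h₁) (congrArg (invIm · b) h₂)
  refine Locale.hom_ext fun (R : FiberProd f g) => ?_
  change pull x R = pull y R
  rw [eq_sSup_rect R, map_sSup, map_sSup]
  congr 1
  refine Set.image_congr ?_
  rintro _ ⟨a, b, -, rfl⟩
  exact key a b

section Lift

variable (x : X ⟶ Y) (y : X ⟶ Z)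

/-- The rectangles whose inverse image under `⟨x, y⟩` is contained in `w`; this is the right
adjoint of the inverse image of the map induced by `x` and `y`. -/
def below (h : x ≫ f = y ≫ g) (w : X) : FiberProd f g where
  carrier := {p | invIm x p.1 ⊓ invIm y p.2 ≤ w}
  lower := fun p q hqp hp =>
    (inf_le_inf (OrderHomClass.mono _ hqp.1) (OrderHomClass.mono _ hqp.2)).trans hp
  sSup_left := fun s b hs => by
    rw [Set.mem_ofPred_eq, map_sSup, sSup_inf_eq, iSup_image]
    exact iSup₂_le hs
  sSup_right := fun a s hs => by
    rw [Set.mem_ofPred_eq, map_sSup, inf_sSup_eq, iSup_image]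
    exact iSup₂_le hs
  balanced := fun a b c => by
    have e : invIm x (invIm f c) = invIm y (invIm g c) := by
      rw [← invIm_comp, h, invIm_comp]
    simp only [Set.mem_ofPred_eq, map_inf, e, inf_assoc, inf_comm (invIm y b)]

theorem gc_below (h : x ≫ f = y ≫ g) :
    GaloisConnection (fun R : FiberProd f g => ⨆ p ∈ R, invIm x p.1 ⊓ invIm y p.2)
      (below x y h) :=
  fun _ _ => iSup₂_le_iff

/-- The map into the fibre product induced by a commutative square. -/
def lift (h : x ≫ f = y ≫ g) : X ⟶ Locale.of (FiberProd f g) :=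
  let φ : FrameHom (FiberProd f g) X :=
    { toFun := fun R => ⨆ p ∈ R, invIm x p.1 ⊓ invIm y p.2
      map_inf' := fun R S => by
        refine le_antisymm (le_inf ?_ ?_) ?_
        · exact (gc_below x y h).monotone_l inf_le_left
        · exact (gc_below x y h).monotone_l inf_le_right
        · rw [iSup₂_inf_eq]
          refine iSup₂_le fun p hp => ?_
          rw [inf_iSup₂_eq]
          refine iSup₂_le fun q hq => ?_
          refine le_trans ?_ (le_iSup₂ (f := fun (p : Y × Z) (_ : p ∈ R ⊓ S) =>
            invIm x p.1 ⊓ invIm y p.2) (p ⊓ q)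
            (mem_inf.2 ⟨R.lower inf_le_left hp, S.lower inf_le_right hq⟩))
          rw [Prod.fst_inf, Prod.snd_inf, map_inf, map_inf, inf_inf_inf_comm]
      map_top' := top_le_iff.1 (le_trans (by simp) (le_iSup₂ (f := fun (p : Y × Z)
        (_ : p ∈ (⊤ : FiberProd f g)) => invIm x p.1 ⊓ invIm y p.2) ⊤
          (rect_le.1 (le_top : rect ⊤ ⊤ ≤ (⊤ : FiberProd f g)))))
      map_sSup' := fun A => (gc_below x y h).l_sSup.trans sSup_image.symm }
  ofInvIm φ

theorem pull_lift_rect (h : x ≫ f = y ≫ g) (a : Y) (b : Z) :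
    pull (lift x y h) (rect a b : FiberProd f g) = invIm x a ⊓ invIm y b :=
  le_antisymm ((gc_below x y h).l_le (rect_le.2 le_rfl))
    (le_iSup₂ (f := fun (p : Y × Z) (_ : p ∈ (rect a b : FiberProd f g)) =>
      invIm x p.1 ⊓ invIm y p.2) (a, b) (mem_rect a b))

theorem lift_fst (h : x ≫ f = y ≫ g) : lift x y h ≫ fst f g = x :=
  Locale.hom_ext fun a =>
    (pull_lift_rect x y h a ⊤).trans (by rw [map_top, inf_top_eq])

theorem lift_snd (h : x ≫ f = y ≫ g) : lift x y h ≫ snd f g = y :=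
  Locale.hom_ext fun b =>
    (pull_lift_rect x y h ⊤ b).trans (by rw [map_top, top_inf_eq])

end Lift

theorem isPullback (f : Y ⟶ B) (g : Z ⟶ B) : IsPullback (fst f g) (snd f g) f g where
  w := condition f g
  isLimit' := ⟨Limits.PullbackCone.IsLimit.mk _ (fun s => lift s.fst s.snd s.condition)
    (fun s => lift_fst _ _ s.condition) (fun s => lift_snd _ _ s.condition)
    (fun s _ h₁ h₂ => hom_ext (h₁.trans (lift_fst _ _ s.condition).symm)
      (h₂.trans (lift_snd _ _ s.condition).symm))⟩

end FiberProd

end Locale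

namespace Locale

variable {X Y Z : Locale.{u}}

/-! ### Monomorphisms and isomorphisms of locales -/

theorem cancel_right_of_surjective {f : Y ⟶ Z} (hf : Function.Surjective (invIm f)) {x y : X ⟶ Y}
    (h : x ≫ f = y ≫ f) : x = y := by
  refine hom_ext fun b => ?_
  obtain ⟨c, rfl⟩ := hf b
  rw [← invIm_comp, h, invIm_comp]

theorem isIso_of_bijective (f : X ⟶ Y) (h : Function.Bijective (invIm f)) : IsIso f := by
  let e := Equiv.ofBijective (invIm f) h
  have he : ∀ b, e b = invIm f b := fun _ => rfl
  have he' : ∀ a, invIm f (e.symm a) = a := e.apply_symm_apply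
  let g : Y ⟶ X := ofInvIm
    { toFun := e.symm
      map_inf' := fun a b => by rw [e.symm_apply_eq, he, map_inf, he', he']
      map_top' := by rw [e.symm_apply_eq, he, map_top]
      map_sSup' := fun s => by
        rw [e.symm_apply_eq, he, map_sSup, Set.image_image]
        simp only [he', Set.image_id'] }
  exact ⟨g, hom_ext he', hom_ext fun b => e.symm_apply_apply b⟩

theorem bijective_invIm (f : X ⟶ Y) [IsIso f] : Function.Bijective (invIm f) := by
  refine Function.bijective_iff_has_inverse.2 ⟨invIm (inv f), fun b => ?_, fun a => ?_⟩
  · rw [← invIm_comp, IsIso.inv_hom_id, invIm_id]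
  · rw [← invIm_comp, IsIso.hom_inv_id, invIm_id]

theorem isOpenRegularMono_of_isIso (f : X ⟶ Y) [IsIso f] : IsOpenRegularMono f := by
  have h : ∀ a, invIm f (invIm (inv f) a) = a := fun a => by
    rw [← invIm_comp, IsIso.hom_inv_id, invIm_id]
  have h' : ∀ b, invIm (inv f) (invIm f b) = b := fun b => by
    rw [← invIm_comp, IsIso.inv_hom_id, invIm_id]
  refine ⟨isOpenMap_of_adjoint (invIm (inv f)) (fun a b => ⟨fun hab => ?_, fun hab => ?_⟩)
    fun a b => by rw [map_inf, h'], (bijective_invIm f).2⟩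
  · rw [← h a]
    exact OrderHomClass.mono _ hab
  · rw [← h' b]
    exact OrderHomClass.mono _ hab

theorem invIm_eq_top_of_factors {V : Y} (k : X ⟶ openSub V) : invIm (k ≫ openIncl V) V = ⊤ := by
  have h : invIm (openIncl V) V = ⊤ := val_injective (inf_idem V)
  rw [invIm_comp, h, map_top]

theorem invIm_openIncl_eq_top {U a : X} : invIm (openIncl U) a = ⊤ ↔ U ≤ a := by
  rw [← inf_eq_right, ← val_invIm_openIncl]
  exact val_injective.eq_iff.symm

theorem val_invIm_eq_iff {U : X} {f : openSub U ⟶ Y} {a : Y} :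
    val (invIm f a) = U ↔ invIm f a = ⊤ :=
  (val_injective (U := U)).eq_iff (b := ⊤)

theorem IsLocalHomeo.comp_iso {f : X ⟶ Y} (hf : IsLocalHomeo f) (g : Y ⟶ Z) [IsIso g] :
    IsLocalHomeo (f ≫ g) := by
  obtain ⟨C, hC, h⟩ := hf
  refine ⟨C, hC, fun c hc => ?_⟩
  rw [← Category.assoc]
  exact (h c hc).comp (isOpenRegularMono_of_isIso g)

theorem IsLocalHomeo.iso_comp {f : Y ⟶ Z} (hf : IsLocalHomeo f) (e : X ⟶ Y) [IsIso e] :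
    IsLocalHomeo (e ≫ f) := by
  obtain ⟨C, hC, h⟩ := hf
  refine ⟨invIm e '' C, by rw [← map_sSup, hC, map_top], ?_⟩
  rintro _ ⟨c, hc, rfl⟩
  let k : openSub (invIm e c) ⟶ openSub c :=
    openLift (openIncl _ ≫ e) c (invIm_openIncl_eq_top.2 le_rfl)
  have hk : k ≫ openIncl c = openIncl (invIm e c) ≫ e := openLift_comp _ _ _
  have hk' : IsOpenRegularMono k := IsOpenRegularMono.of_comp_openIncl (by
    rw [hk]
    exact (openIncl_isOpenRegularMono _).comp (isOpenRegularMono_of_isIso e))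
  rw [← Category.assoc, ← hk, Category.assoc]
  exact hk'.comp (h c hc)

end Locale

namespace LocalicGroupoid

open Locale

variable {G : LocalicGroupoid.{u}} {X Y : Locale.{u}}

/-! ### Generalized elements of a localic groupoid -/

theorem comp_congr {x x' y y' : X ⟶ G.G₁} (hx : x = x') (hy : y = y')
    (h : x ≫ G.str.r = y ≫ G.str.d) : G.comp x y h = G.comp x' y' (by rw [← hx, ← hy, h]) := by
  subst hx hy
  rfl

theorem precomp_comp (k : Y ⟶ X) (x y : X ⟶ G.G₁) (h : x ≫ G.str.r = y ≫ G.str.d) :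
    k ≫ G.comp x y h = G.comp (k ≫ x) (k ≫ y) (by simp [h]) := by
  rw [comp, comp, ← Category.assoc]
  congr 1
  apply G.str.isPullback.hom_ext <;> simp

theorem comp_d (x y : X ⟶ G.G₁) (h : x ≫ G.str.r = y ≫ G.str.d) :
    G.comp x y h ≫ G.str.d = x ≫ G.str.d := by
  rw [comp, Category.assoc, G.str.m_d, IsPullback.lift_fst_assoc]

theorem comp_r (x y : X ⟶ G.G₁) (h : x ≫ G.str.r = y ≫ G.str.d) :
    G.comp x y h ≫ G.str.r = y ≫ G.str.r := by
  rw [comp, Category.assoc, G.str.m_r, IsPullback.lift_snd_assoc]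

theorem unit_comp (x : X ⟶ G.G₁) :
    G.comp (x ≫ G.str.d ≫ G.str.u) x (by simp [G.str.u_r]) = x := by
  have h := precomp_comp (G := G) x (G.str.d ≫ G.str.u) (𝟙 _) (by simp [G.str.u_r])
  rw [show G.comp (G.str.d ≫ G.str.u) (𝟙 _) _ = 𝟙 _ from G.str.unit_left] at h
  exact (comp_congr rfl (Category.comp_id x).symm _).trans (h.symm.trans (Category.comp_id x))

theorem comp_unit (x : X ⟶ G.G₁) :
    G.comp x (x ≫ G.str.r ≫ G.str.u) (by simp [G.str.u_d]) = x := by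
  have h := precomp_comp (G := G) x (𝟙 _) (G.str.r ≫ G.str.u) (by simp [G.str.u_d])
  rw [show G.comp (𝟙 _) (G.str.r ≫ G.str.u) _ = 𝟙 _ from G.str.unit_right] at h
  exact (comp_congr (Category.comp_id x).symm rfl _).trans (h.symm.trans (Category.comp_id x))

theorem comp_inv (x : X ⟶ G.G₁) :
    G.comp x (x ≫ G.str.i) (by simp [G.str.i_d]) = x ≫ G.str.d ≫ G.str.u := by
  have h := precomp_comp (G := G) x (𝟙 _) G.str.i (by simp [G.str.i_d])
  rw [show G.comp (𝟙 _) G.str.i _ = G.str.d ≫ G.str.u from G.str.inv_right] at h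
  exact (comp_congr (Category.comp_id x).symm rfl _).trans h.symm

theorem inv_comp (x : X ⟶ G.G₁) :
    G.comp (x ≫ G.str.i) x (by simp [G.str.i_r]) = x ≫ G.str.r ≫ G.str.u := by
  have h := precomp_comp (G := G) x G.str.i (𝟙 _) (by simp [G.str.i_r])
  rw [show G.comp G.str.i (𝟙 _) _ = G.str.r ≫ G.str.u from G.str.inv_left] at h
  exact (comp_congr rfl (Category.comp_id x).symm _).trans h.symm

theorem comp_assoc (x y z : X ⟶ G.G₁) (hxy : x ≫ G.str.r = y ≫ G.str.d)
    (hyz : y ≫ G.str.r = z ≫ G.str.d) :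
    G.comp (G.comp x y hxy) z ((comp_r x y hxy).trans hyz) =
      G.comp x (G.comp y z hyz) (hxy.trans (comp_d y z hyz).symm) :=
  G.str.assoc x y z hxy hyz

theorem inv_inv (x : X ⟶ G.G₁) : (x ≫ G.str.i) ≫ G.str.i = x := by
  have h := comp_assoc ((x ≫ G.str.i) ≫ G.str.i) (x ≫ G.str.i) x (by simp [G.str.i_r])
    (by simp [G.str.i_r])
  -- Both ways of bracketing `x⁻¹⁻¹ x⁻¹ x` reduce by a unit law.
  have h₁ := comp_congr (G := G) (inv_comp (x ≫ G.str.i)) (rfl : x = x)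
    (by simp [comp_r, G.str.i_r])
  have h₂ := comp_congr (G := G) (rfl : (x ≫ G.str.i) ≫ G.str.i = _) (inv_comp x)
    (by simp [comp_d, G.str.i_r])
  have h₃ := comp_congr (G := G) (show (x ≫ G.str.i) ≫ G.str.r ≫ G.str.u = x ≫ G.str.d ≫ G.str.u by
    rw [Category.assoc, reassoc_of% G.str.i_r]) (rfl : x = x) (by simp [G.str.u_r, G.str.i_r])
  have h₄ := comp_congr (G := G) (rfl : (x ≫ G.str.i) ≫ G.str.i = _)
    (show x ≫ G.str.r ≫ G.str.u = ((x ≫ G.str.i) ≫ G.str.i) ≫ G.str.r ≫ G.str.u by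
      simp only [Category.assoc, reassoc_of% G.str.i_r, reassoc_of% G.str.i_d])
    (by simp [G.str.u_d, G.str.i_r, G.str.i_d])
  rw [h₁, h₂, h₃, h₄, unit_comp, comp_unit] at h
  exact h.symm

namespace LocalBisection

/-! ### Generalized elements of local bisections -/

/-- The generalized element `x` of `G₁` lies in the local bisection `σ`, regarded as a subobject
of `G₁`. -/
def Contains (σ : G.LocalBisection) (x : X ⟶ G.G₁) : Prop :=
  ∃ k : X ⟶ openSub σ.U, k ≫ σ.s = x

theorem contains_self (σ : G.LocalBisection) : σ.Contains σ.s := ⟨𝟙 _, Category.id_comp _⟩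

theorem Contains.precomp {σ : G.LocalBisection} {x : X ⟶ G.G₁} (h : σ.Contains x) (k : Y ⟶ X) :
    σ.Contains (k ≫ x) := by
  obtain ⟨l, rfl⟩ := h
  exact ⟨k ≫ l, Category.assoc _ _ _⟩

theorem Contains.invIm_d_U {σ : G.LocalBisection} {x : X ⟶ G.G₁} (h : σ.Contains x) :
    invIm (x ≫ G.str.d) σ.U = ⊤ := by
  obtain ⟨k, rfl⟩ := h
  rw [Category.assoc, σ.s_d]
  exact invIm_eq_top_of_factors k

/-- The inverse image of `a` under an element `x` of `σ` is that of `s_σ^*(a)` under the domain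
of `x`. -/
theorem Contains.invIm_eq {σ : G.LocalBisection} {x : X ⟶ G.G₁} (h : σ.Contains x) (a : G.G₁) :
    invIm x a = invIm (x ≫ G.str.d) (val (invIm σ.s a)) := by
  obtain ⟨k, rfl⟩ := h
  rw [Category.assoc, σ.s_d, invIm_comp, invIm_comp]
  congr 1
  exact val_injective (inf_eq_left.2 (val_le _)).symm

theorem Contains.eq_of_d_eq {σ : G.LocalBisection} {x y : X ⟶ G.G₁} (hx : σ.Contains x)
    (hy : σ.Contains y) (h : x ≫ G.str.d = y ≫ G.str.d) : x = y :=
  hom_ext fun a => by rw [hx.invIm_eq, hy.invIm_eq, h]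

theorem Contains.eq_of_r_eq {σ : G.LocalBisection} {x y : X ⟶ G.G₁} (hx : σ.Contains x)
    (hy : σ.Contains y) (h : x ≫ G.str.r = y ≫ G.str.r) : x = y := by
  obtain ⟨k, rfl⟩ := hx
  obtain ⟨l, rfl⟩ := hy
  rw [Category.assoc, Category.assoc] at h
  rw [cancel_right_of_surjective σ.s_r.2 h]

theorem contains_restrict {σ : G.LocalBisection} {W : G.G₀} {h : W ≤ σ.U} {x : X ⟶ G.G₁} :
    (σ.restrict W h).Contains x ↔ σ.Contains x ∧ invIm (x ≫ G.str.d) W = ⊤ := by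
  constructor
  · intro hx
    refine ⟨?_, hx.invIm_d_U⟩
    obtain ⟨k, rfl⟩ := hx
    exact ⟨k ≫ openInclLE h, Category.assoc _ _ _⟩
  · rintro ⟨hx, hW⟩
    refine ⟨openLift (x ≫ G.str.d) W hW, Contains.eq_of_d_eq (σ := σ)
      ⟨openLift (x ≫ G.str.d) W hW ≫ openInclLE h, Category.assoc _ _ _⟩ hx ?_⟩
    exact (congrArg (openLift (x ≫ G.str.d) W hW ≫ ·) (σ.restrict W h).s_d).trans
      (openLift_comp _ _ _)

/-- The order of local bisections is the inclusion of subobjects of `G₁`. -/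
theorem le_iff_contains {σ τ : G.LocalBisection} : σ ≤ τ ↔ τ.Contains σ.s := by
  constructor
  · rintro ⟨h, h'⟩
    exact ⟨openInclLE h, h'⟩
  · intro h
    have hU := h.invIm_d_U
    rw [σ.s_d, invIm_openIncl_eq_top] at hU
    refine le_iff.2 ⟨hU, fun a => ?_⟩
    rw [h.invIm_eq, σ.s_d, val_invIm_openIncl]

theorem Contains.mono {σ τ : G.LocalBisection} {x : X ⟶ G.G₁} (hx : σ.Contains x) (h : σ ≤ τ) :
    τ.Contains x := by
  obtain ⟨k, rfl⟩ := hx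
  exact (le_iff_contains.1 h).precomp k

theorem Contains.of_le {σ τ : G.LocalBisection} {x : X ⟶ G.G₁} (hx : τ.Contains x) (h : σ ≤ τ)
    (hU : invIm (x ≫ G.str.d) σ.U = ⊤) : σ.Contains x := by
  refine ((contains_restrict (h := (le_iff.1 h).1)).2 ⟨hx, hU⟩).mono
    (le_iff.2 ⟨le_rfl, fun a => ?_⟩)
  change val (invIm τ.s a) ⊓ σ.U = val (invIm σ.s a) ⊓ σ.U
  rw [(le_iff.1 h).2, inf_assoc, inf_idem]

theorem le_restrict {σ τ : G.LocalBisection} {W : G.G₀} {h : W ≤ σ.U} (hτ : τ ≤ σ)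
    (hW : τ.U ≤ W) : τ ≤ σ.restrict W h := by
  rw [le_iff_contains, contains_restrict, τ.s_d, invIm_openIncl_eq_top]
  exact ⟨le_iff_contains.1 hτ, hW⟩

theorem restrict_mono {σ : G.LocalBisection} {W W' : G.G₀} (h : W ≤ σ.U) (h' : W' ≤ σ.U)
    (hW : W ≤ W') : σ.restrict W h ≤ σ.restrict W' h' :=
  le_restrict (σ.restrict_le W h) hW

/-! ### The inverse semigroup of local bisections -/

theorem Contains.mul {σ τ : G.LocalBisection} {x y : X ⟶ G.G₁} (hx : σ.Contains x)
    (hy : τ.Contains y) (h : x ≫ G.str.r = y ≫ G.str.d) : (σ * τ).Contains (G.comp x y h) := by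
  have hD : invIm (x ≫ G.str.d) (mulDom σ τ) = ⊤ := by
    rw [mulDom, ← hx.invIm_eq, ← invIm_comp, h, hy.invIm_d_U]
  let k : X ⟶ openSub (mulDom σ τ) := openLift (x ≫ G.str.d) _ hD
  have hk : k ≫ openIncl _ = x ≫ G.str.d := openLift_comp _ _ _
  have h₁ : k ≫ openInclLE (val_le _ : mulDom σ τ ≤ σ.U) ≫ σ.s = x := by
    refine Contains.eq_of_d_eq (σ := σ) ⟨k ≫ openInclLE _, Category.assoc _ _ _⟩ hx ?_
    rw [← hk, Category.assoc, Category.assoc, σ.s_d]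
    exact congrArg (k ≫ ·) (openInclLE_comp _)
  have h₂ : k ≫ mulMap σ τ ≫ τ.s = y := by
    refine Contains.eq_of_d_eq (σ := τ) ⟨k ≫ mulMap σ τ, Category.assoc _ _ _⟩ hy ?_
    rw [← h, ← h₁, Category.assoc, Category.assoc, τ.s_d, mulMap_comp]
    simp only [Category.assoc]
    rfl
  exact ⟨k, (precomp_comp _ _ _ _).trans (comp_congr h₁ h₂ _)⟩

theorem Contains.exists_of_mul {σ τ : G.LocalBisection} {z : X ⟶ G.G₁} (hz : (σ * τ).Contains z) :
    ∃ (x y : X ⟶ G.G₁) (h : x ≫ G.str.r = y ≫ G.str.d),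
      σ.Contains x ∧ τ.Contains y ∧ z = G.comp x y h := by
  obtain ⟨k, rfl⟩ := hz
  exact ⟨_, _, _, ⟨k ≫ openInclLE _, Category.assoc _ _ _⟩,
    ⟨k ≫ mulMap σ τ, Category.assoc _ _ _⟩, precomp_comp k _ _ _⟩

theorem mul_mono {σ σ' τ τ' : G.LocalBisection} (hσ : σ ≤ σ') (hτ : τ ≤ τ') :
    σ * τ ≤ σ' * τ' := by
  obtain ⟨x, y, h, hx, hy, e⟩ := (contains_self (σ * τ)).exists_of_mul
  rw [le_iff_contains, e]
  exact (hx.mono hσ).mul (hy.mono hτ) h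

theorem mul_assoc (σ τ ρ : G.LocalBisection) : σ * τ * ρ = σ * (τ * ρ) := by
  refine le_antisymm (le_iff_contains.2 ?_) (le_iff_contains.2 ?_)
  · obtain ⟨w, z, h, hw, hz, e⟩ := (contains_self (σ * τ * ρ)).exists_of_mul
    obtain ⟨x, y, h', hx, hy, rfl⟩ := hw.exists_of_mul
    rw [e, comp_assoc x y z h' ((comp_r x y h').symm.trans h)]
    exact hx.mul (hy.mul hz _) _
  · obtain ⟨x, w, h, hx, hw, e⟩ := (contains_self (σ * (τ * ρ))).exists_of_mul
    obtain ⟨y, z, h', hy, hz, rfl⟩ := hw.exists_of_mul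
    rw [e, ← comp_assoc x y z (h.trans (comp_d y z h')) h']
    exact (hx.mul hy _).mul hz _

/-- The idempotent local bisection `ε|_W`. -/
def idem (W : G.G₀) : G.LocalBisection := (unit G).restrict W le_top

theorem contains_unit {x : X ⟶ G.G₁} : (unit G).Contains x ↔ x = x ≫ G.str.d ≫ G.str.u := by
  constructor
  · rintro ⟨k, rfl⟩
    rw [Category.assoc, reassoc_of% (unit G).s_d]
    rfl
  · intro h
    rw [h]
    refine ⟨openLift (x ≫ G.str.d) ⊤ (map_top _), ?_⟩
    change openLift (x ≫ G.str.d) ⊤ _ ≫ openIncl ⊤ ≫ G.str.u = _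
    rw [← Category.assoc, openLift_comp, Category.assoc]

theorem contains_idem {W : G.G₀} {x : X ⟶ G.G₁} :
    (idem W).Contains x ↔ x = x ≫ G.str.d ≫ G.str.u ∧ invIm (x ≫ G.str.d) W = ⊤ := by
  exact contains_restrict.trans (and_congr_left' contains_unit)

theorem idem_eq_of_le_unit {β : G.LocalBisection} (h : β ≤ unit G) : idem β.U = β :=
  le_antisymm (le_iff_contains.2 (((contains_self _).mono (restrict_le _ _ _)).of_le h
    (contains_self (idem β.U)).invIm_d_U)) (le_restrict h le_rfl)

theorem le_idem_mul {σ : G.LocalBisection} {W : G.G₀} (h : σ.U ≤ W) : σ ≤ idem W * σ := by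
  rw [le_iff_contains, ← unit_comp σ.s]
  refine Contains.mul (contains_idem.2 ⟨?_, ?_⟩) (contains_self σ) _
  · simp only [Category.assoc, reassoc_of% G.str.u_d]
  · simpa only [Category.assoc, G.str.u_d, Category.comp_id, σ.s_d, invIm_openIncl_eq_top]

theorem le_mul_idem {σ : G.LocalBisection} {W : G.G₀} (h : invIm (σ.s ≫ G.str.r) W = ⊤) :
    σ ≤ σ * idem W := by
  rw [le_iff_contains, ← comp_unit σ.s]
  refine Contains.mul (contains_self σ) (contains_idem.2 ⟨?_, ?_⟩) _
  · simp only [Category.assoc, reassoc_of% G.str.u_d]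
  · simpa only [Category.assoc, G.str.u_d, Category.comp_id]

theorem unit_mul_le (σ : G.LocalBisection) : unit G * σ ≤ σ := by
  obtain ⟨x, y, h, hx, hy, e⟩ := (contains_self (unit G * σ)).exists_of_mul
  rw [contains_unit] at hx
  have hx' : x = y ≫ G.str.d ≫ G.str.u := by
    have h' : x ≫ G.str.d = x ≫ G.str.r := by
      conv_rhs => rw [hx]
      simp only [Category.assoc, G.str.u_r, Category.comp_id]
    rw [← reassoc_of% h, ← reassoc_of% h']
    exact hx
  rw [le_iff_contains, e, comp_congr hx' rfl, unit_comp]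
  exact hy

theorem mul_unit_le (σ : G.LocalBisection) : σ * unit G ≤ σ := by
  obtain ⟨x, y, h, hx, hy, e⟩ := (contains_self (σ * unit G)).exists_of_mul
  rw [contains_unit] at hy
  have hy' : y = x ≫ G.str.r ≫ G.str.u := by
    rw [reassoc_of% h]
    exact hy
  rw [le_iff_contains, e, comp_congr rfl hy', comp_unit]
  exact hx

theorem Contains.inverse {σ : G.LocalBisection} {x : X ⟶ G.G₁} (hx : σ.Contains x) :
    σ.inverse.Contains (x ≫ G.str.i) := by
  obtain ⟨k, rfl⟩ := hx
  let α : openSub σ.U ⟶ openSub σ.V := openLift (σ.s ≫ G.str.r) σ.V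
    (top_le_iff.1 (σ.s_r.1.1.le_u_l ⊤))
  have hα : α ≫ invOnImage (σ.s ≫ G.str.r) σ.s_r = 𝟙 _ :=
    hom_ext fun a => by
      rw [invIm_comp, invIm_openLift, val_invIm_invOnImage, σ.s_r.invIm_dirIm, invIm_id]
  refine ⟨k ≫ α, ?_⟩
  simp only [LocalBisection.inverse, t, Category.assoc, reassoc_of% hα]

theorem contains_inverse {σ : G.LocalBisection} {x : X ⟶ G.G₁} :
    σ.inverse.Contains x ↔ σ.Contains (x ≫ G.str.i) := by
  constructor
  · rintro ⟨k, rfl⟩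
    have h : σ.inverse.s ≫ G.str.i = σ.t := inv_inv σ.t
    rw [Category.assoc, h]
    exact ((contains_self σ).precomp _).precomp k
  · intro h
    rw [← inv_inv x]
    exact h.inverse

theorem inverse_inverse (σ : G.LocalBisection) : σ.inverse.inverse = σ := by
  refine le_antisymm (le_iff_contains.2 ?_) (le_iff_contains.2 ?_)
  · rw [← inv_inv σ.inverse.inverse.s, ← contains_inverse, ← contains_inverse]
    exact contains_self _
  · rw [contains_inverse, contains_inverse, inv_inv]
    exact contains_self _

theorem inverse_mono {σ τ : G.LocalBisection} (h : σ ≤ τ) : σ.inverse ≤ τ.inverse := by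
  rw [le_iff_contains, contains_inverse]
  exact (contains_inverse.1 (contains_self _)).mono h

theorem inverse_le_iff {σ τ : G.LocalBisection} : σ.inverse ≤ τ ↔ σ ≤ τ.inverse :=
  ⟨fun h => by simpa only [inverse_inverse] using inverse_mono h,
    fun h => by simpa only [inverse_inverse] using inverse_mono h⟩

theorem mul_inverse (σ : G.LocalBisection) : σ * σ.inverse = idem σ.U := by
  refine le_antisymm (le_iff_contains.2 ?_) (le_iff_contains.2 ?_)
  · obtain ⟨x, y, h, hx, hy, e⟩ := (contains_self (σ * σ.inverse)).exists_of_mul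
    rw [contains_inverse] at hy
    have hxy : x = y ≫ G.str.i := hx.eq_of_r_eq hy (by rw [Category.assoc, G.str.i_r, h])
    have hy' : y = x ≫ G.str.i := by rw [hxy, inv_inv]
    rw [e, comp_congr rfl hy', comp_inv, contains_idem]
    simp only [Category.assoc, reassoc_of% G.str.u_d, G.str.u_d, Category.comp_id, true_and]
    exact hx.invIm_d_U
  · have hU : (idem σ.U).s = σ.s ≫ G.str.d ≫ G.str.u := by
      rw [reassoc_of% σ.s_d]
      change openInclLE _ ≫ openIncl ⊤ ≫ G.str.u = _
      rw [← Category.assoc, openInclLE_comp]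
    rw [hU, ← comp_inv]
    exact (contains_self σ).mul (contains_self σ).inverse _

end LocalBisection

end LocalicGroupoid

namespace LocalicGroupoid

open Locale LocalBisection

variable {G : LocalicGroupoid.{u}} {X Y : Locale.{u}}

/-! ### The frame of the completion and its universal property -/

namespace Completion

theorem mem_hat {σ τ : G.LocalBisection} : τ ∈ hat σ ↔ τ ≤ σ := Iff.rfl

theorem hat_le {σ : G.LocalBisection} {A : G.Completion} : hat σ ≤ A ↔ σ ∈ A :=
  ⟨fun h => h (le_refl σ), fun h _ hτ => A.lower hτ h⟩

theorem hat_mono {σ τ : G.LocalBisection} (h : σ ≤ τ) : hat σ ≤ hat τ := hat_le.2 h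

theorem mem_inf {A B : G.Completion} {σ : G.LocalBisection} : σ ∈ A ⊓ B ↔ σ ∈ A ∧ σ ∈ B := by
  rw [← sInf_pair, mem_sInf]
  simp

theorem mem_top (σ : G.LocalBisection) : σ ∈ (⊤ : G.Completion) := hat_le.1 le_top

theorem mul_le {A B C : G.Completion} : A * B ≤ C ↔ ∀ σ ∈ A, ∀ τ ∈ B, σ * τ ∈ C :=
  ⟨fun h σ hσ τ hτ => h (mem_sInf.2 fun _ hc => hc σ hσ τ hτ), fun h => sInf_le h⟩

theorem mul_mem_mul {A B : G.Completion} {σ τ : G.LocalBisection} (hσ : σ ∈ A) (hτ : τ ∈ B) :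
    σ * τ ∈ A * B :=
  mul_le.1 le_rfl σ hσ τ hτ

theorem star_le {A C : G.Completion} : star A ≤ C ↔ ∀ σ ∈ A, σ.inverse ∈ C :=
  ⟨fun h σ hσ => h (mem_sInf.2 fun _ hc => hc σ hσ), fun h => sInf_le h⟩

/-- The largest element of the completion at whose members `φ` takes values below `w`. -/
def below (φ : G.LocalBisection → X) (mono : ∀ ⦃σ τ⦄, σ ≤ τ → φ σ ≤ φ τ)
    (cover : ∀ (S : Set G.LocalBisection) (σ), IsLUB S σ → φ σ ≤ ⨆ ρ ∈ S, φ ρ) (w : X) :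
    G.Completion where
  carrier := {σ | φ σ ≤ w}
  lower := fun _ _ h hσ => (mono h).trans hσ
  closed := fun S σ hS hσ => (cover S σ hσ).trans (iSup₂_le fun _ hρ => hS hρ)

/-- The universal property of the completion: an order preserving map on the local bisections that
preserves the existing joins and is flat (it covers the top element, and binary meets are covered
by common lower bounds) extends to a homomorphism of frames. -/
def extend (φ : G.LocalBisection → X) (mono : ∀ ⦃σ τ⦄, σ ≤ τ → φ σ ≤ φ τ)
    (cover : ∀ (S : Set G.LocalBisection) (σ), IsLUB S σ → φ σ ≤ ⨆ ρ ∈ S, φ ρ)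
    (top : ⊤ ≤ ⨆ σ, φ σ)
    (inf : ∀ (σ τ) (w : X), (∀ ρ, ρ ≤ σ → ρ ≤ τ → φ ρ ≤ w) → φ σ ⊓ φ τ ≤ w) :
    FrameHom G.Completion X :=
  have gc : GaloisConnection (fun A : G.Completion => ⨆ σ ∈ A, φ σ) (below φ mono cover) :=
    fun _ _ => iSup₂_le_iff
  { toFun := fun A => ⨆ σ ∈ A, φ σ
    map_inf' := fun A B => by
      refine le_antisymm (le_inf (gc.monotone_l inf_le_left) (gc.monotone_l inf_le_right)) ?_
      rw [iSup₂_inf_eq]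
      refine iSup₂_le fun σ hσ => ?_
      rw [inf_iSup₂_eq]
      refine iSup₂_le fun τ hτ => inf σ τ _ fun ρ h h' => ?_
      exact le_iSup₂ (f := fun ρ (_ : ρ ∈ A ⊓ B) => φ ρ) ρ
        (mem_inf.2 ⟨A.lower h hσ, B.lower h' hτ⟩)
    map_top' := top_le_iff.1 (top.trans (iSup_le fun σ =>
      le_iSup₂ (f := fun ρ (_ : ρ ∈ (⊤ : G.Completion)) => φ ρ) σ (mem_top σ)))
    map_sSup' := fun A => gc.l_sSup.trans sSup_image.symm }

theorem le_iSup_hat (A : G.Completion) : A ≤ ⨆ σ ∈ A, hat σ := fun σ hσ =>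
  hat_le.1 (le_iSup₂ (f := fun σ (_ : σ ∈ A) => hat σ) σ hσ)

theorem hat_le_of_isLUB {S : Set G.LocalBisection} {σ : G.LocalBisection} (h : IsLUB S σ) :
    hat σ ≤ ⨆ ρ ∈ S, hat ρ :=
  hat_le.2 (Completion.closed _ S σ (fun ρ hρ =>
    hat_le.1 (le_iSup₂ (f := fun σ (_ : σ ∈ S) => hat σ) ρ hρ)) h)

/-! ### Maps into the locale of germs -/

theorem pull_hat_le {x : X ⟶ Locale.of G.Completion} {A : G.Completion} {σ : G.LocalBisection}
    (h : σ ∈ A) : pull x (hat σ) ≤ pull x A :=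
  OrderHomClass.mono _ (hat_le.2 h)

/-- Every open of the locale of germs is a join of principal ones, so that an inequality below the
inverse image of `A` can be verified on the charts `σ̂` with `σ ∈ A`. -/
theorem inf_pull_le {x : X ⟶ Locale.of G.Completion} {A : G.Completion} {v w : X}
    (h : ∀ σ ∈ A, v ⊓ pull x (hat σ) ≤ w) : v ⊓ pull x A ≤ w := by
  refine (inf_le_inf_left v (OrderHomClass.mono (pull x) (le_iSup_hat A))).trans ?_
  rw [map_iSup₂, inf_iSup₂_eq]
  exact iSup₂_le h

theorem pull_le {x : X ⟶ Locale.of G.Completion} {A : G.Completion} {w : X}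
    (h : ∀ σ ∈ A, pull x (hat σ) ≤ w) : pull x A ≤ w :=
  (le_inf le_top le_rfl).trans (inf_pull_le (v := ⊤) fun σ hσ => inf_le_right.trans (h σ hσ))

theorem le_of_inf_pull_le {x : X ⟶ Locale.of G.Completion} {v w : X}
    (h : ∀ σ, v ⊓ pull x (hat σ) ≤ w) : v ≤ w :=
  (le_inf le_rfl (le_top.trans (map_top (pull x)).ge)).trans (inf_pull_le fun σ _ => h σ)

end Completion

open Completion

/-! ### The comparison map from the locale of germs -/

theorem mem_j {a : G.G₁} {σ : G.LocalBisection} : σ ∈ j a ↔ invIm σ.s a = ⊤ := val_invIm_eq_iff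

/-- The part of a local bisection that lies in the open `a` of `G₁`. -/
def LocalBisection.part (σ : G.LocalBisection) (a : G.G₁) : G.LocalBisection :=
  σ.restrict (val (invIm σ.s a)) (val_le _)

theorem LocalBisection.part_le (σ : G.LocalBisection) (a : G.G₁) : σ.part a ≤ σ :=
  σ.restrict_le _ _

theorem LocalBisection.contains_part {σ : G.LocalBisection} {a : G.G₁} {x : X ⟶ G.G₁} :
    (σ.part a).Contains x ↔ σ.Contains x ∧ invIm x a = ⊤ :=
  contains_restrict.trans (and_congr_right fun h => by rw [h.invIm_eq])

theorem LocalBisection.le_part_iff {σ τ : G.LocalBisection} {a : G.G₁} :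
    τ ≤ σ.part a ↔ τ ≤ σ ∧ τ ∈ j a := by
  rw [le_iff_contains, contains_part, ← le_iff_contains, mem_j]

theorem j_inf_hat (σ : G.LocalBisection) (a : G.G₁) : j a ⊓ hat σ = hat (σ.part a) :=
  SetLike.ext fun τ => by rw [mem_inf, mem_hat, mem_hat, le_part_iff, and_comm]

theorem mem_j_d {W : G.G₀} {σ : G.LocalBisection} : σ ∈ j (invIm G.str.d W) ↔ σ.U ≤ W := by
  rw [mem_j, ← invIm_comp, σ.s_d, invIm_openIncl_eq_top]

theorem mem_j_r {W : G.G₀} {σ : G.LocalBisection} :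
    σ ∈ j (invIm G.str.r W) ↔ invIm (σ.s ≫ G.str.r) W = ⊤ := by
  rw [mem_j, invIm_comp]

/-- The comparison map from the locale of germs to `G₁`, with inverse image `j`. -/
def germMap (G : LocalicGroupoid.{u}) : Locale.of G.Completion ⟶ G.G₁ :=
  let φ : FrameHom G.G₁ G.Completion :=
    { toFun := j
      map_inf' := fun a b => SetLike.ext fun σ => by
        rw [mem_inf, mem_j, mem_j, mem_j, map_inf, inf_eq_top_iff]
      map_top' := top_le_iff.1 fun σ _ => mem_j.2 (map_top _)
      map_sSup' := fun s => by
        refine le_antisymm (fun σ hσ => ?_) (sSup_le ?_)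
        · have hσ' : val (invIm σ.s (sSup s)) = σ.U := hσ
          rw [map_sSup, val_sSup] at hσ'
          -- `σ` is the join of its parts in the members of `s`.
          refine Completion.closed _ (σ.part '' s) σ ?_ (isLUB_of_le_sSup ?_ ?_)
          · rintro _ ⟨a, ha, rfl⟩
            exact le_sSup (Set.mem_image_of_mem j ha) (le_part_iff.1 le_rfl).2
          · rintro _ ⟨a, -, rfl⟩
            exact σ.part_le a
          · rw [← hσ', Set.image_image, Set.image_image]
            exact le_rfl
        · rintro _ ⟨a, ha, rfl⟩ σ hσ
          rw [mem_j] at hσ ⊢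
          exact top_le_iff.1 (hσ.ge.trans (OrderHomClass.mono _ (le_sSup ha))) }
  ofInvIm φ

theorem invIm_germMap (a : G.G₁) : invIm (germMap G) a = j a := rfl

theorem pull_j_inf_hat (x : X ⟶ Locale.of G.Completion) (σ : G.LocalBisection) (a : G.G₁) :
    pull x (j a) ⊓ pull x (hat σ) = pull x (hat (σ.part a)) := by
  rw [← map_inf, j_inf_hat]

/-- A generalized element of the locale of germs that lies in `σ̂` maps to a generalized element
of `σ`. -/
theorem contains_comp_germMap {x : X ⟶ Locale.of G.Completion} {σ : G.LocalBisection}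
    (h : pull x (hat σ) = ⊤) : σ.Contains (x ≫ germMap G) := by
  have key : ∀ a, pull x (j a) = pull x (hat (σ.part a)) := fun a => by
    rw [← pull_j_inf_hat, h, inf_top_eq]
  have hU : invIm (x ≫ germMap G ≫ G.str.d) σ.U = ⊤ :=
    top_le_iff.1 (h.ge.trans (pull_hat_le (mem_j_d.2 le_rfl)))
  refine ⟨openLift (x ≫ germMap G ≫ G.str.d) σ.U hU, hom_ext fun a => ?_⟩
  change pull x (j (invIm G.str.d (val (invIm σ.s a)))) = pull x (j a)
  refine le_antisymm ?_ ?_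
  · rw [key, key]
    refine OrderHomClass.mono _ (hat_mono (le_part_iff.2 ⟨part_le _ _, ?_⟩))
    have h' : σ.part (invIm G.str.d (val (invIm σ.s a))) ≤ σ.part a := by
      refine restrict_mono _ _ ?_
      rw [← invIm_comp, σ.s_d, val_invIm_openIncl]
      exact inf_le_left
    exact (le_part_iff.1 h').2
  · rw [key a]
    exact pull_hat_le (mem_j_d.2 le_rfl)

/-! ### Multiplication of germs -/

/-- The open where `x y` lies in the principal element of `ρ`, for generalized elements `x` and `y`
of the locale of germs. -/
def mulVal (x y : X ⟶ Locale.of G.Completion) (ρ : G.LocalBisection) : X :=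
  ⨆ (σ : G.LocalBisection) (τ : G.LocalBisection) (_ : σ * τ ≤ ρ), pull x (hat σ) ⊓ pull y (hat τ)

theorem mulVal_le {x y : X ⟶ Locale.of G.Completion} {ρ : G.LocalBisection} {w : X} :
    mulVal x y ρ ≤ w ↔ ∀ σ τ, σ * τ ≤ ρ → pull x (hat σ) ⊓ pull y (hat τ) ≤ w := by
  simp only [mulVal, iSup_le_iff]

theorem le_mulVal {x y : X ⟶ Locale.of G.Completion} {σ τ ρ : G.LocalBisection} (h : σ * τ ≤ ρ) :
    pull x (hat σ) ⊓ pull y (hat τ) ≤ mulVal x y ρ :=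
  mulVal_le.1 le_rfl σ τ h

/-- Two generalized elements of the locale of germs are composable. -/
abbrev Composable (x y : X ⟶ Locale.of G.Completion) : Prop :=
  (x ≫ germMap G) ≫ G.str.r = (y ≫ germMap G) ≫ G.str.d

/-- On the product of `σ` and `τ` only the part of `σ` over the domain of `σ τ` matters. -/
theorem Composable.pull_inf_le {x y : X ⟶ Locale.of G.Completion} (h : Composable x y)
    (σ τ : G.LocalBisection) :
    pull x (hat σ) ⊓ pull y (hat τ) ≤ pull x (hat (σ.part (invIm G.str.r τ.U))) := by
  have e : pull x (j (invIm G.str.r τ.U)) = pull y (j (invIm G.str.d τ.U)) :=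
    congrArg (invIm · τ.U) h
  rw [← pull_j_inf_hat, inf_comm, e]
  exact inf_le_inf_right _ (pull_hat_le (mem_j_d.2 le_rfl))

/-- If `ρ` is the join of `S`, the part of `σ` over the domain of `σ τ ≤ ρ` is the join of its
restrictions `σ'` to the domains of the members `κ` of `S`, and these satisfy `σ' τ ≤ κ`. -/
theorem Composable.mulVal_cover {x y : X ⟶ Locale.of G.Completion} (h : Composable x y)
    {S : Set G.LocalBisection} {ρ : G.LocalBisection} (hS : IsLUB S ρ) :
    mulVal x y ρ ≤ ⨆ κ ∈ S, mulVal x y κ := by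
  refine mulVal_le.2 fun σ τ hρ => ?_
  have hle : ∀ κ : G.LocalBisection, mulDom σ τ ⊓ κ.U ≤ σ.U := fun κ =>
    inf_le_left.trans (val_le _)
  have hlub : IsLUB ((fun κ => σ.restrict _ (hle κ)) '' S) (σ.part (invIm G.str.r τ.U)) := by
    refine isLUB_of_le_sSup ?_ ?_
    · rintro _ ⟨κ, -, rfl⟩
      exact restrict_mono _ _ inf_le_left
    · have h₁ : mulDom σ τ ≤ sSup (U '' S) := (le_iff.1 hρ).1.trans (le_sSup_of_isLUB hS)
      refine (le_inf (le_refl (mulDom σ τ)) h₁).trans ?_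
      rw [inf_sSup_eq]
      refine iSup₂_le ?_
      rintro _ ⟨κ, hκ, rfl⟩
      exact le_sSup ⟨_, ⟨κ, hκ, rfl⟩, rfl⟩
  refine (le_inf (h.pull_inf_le σ τ) inf_le_right).trans ?_
  refine (inf_le_inf_right _ (OrderHomClass.mono (pull x) (hat_le_of_isLUB hlub))).trans ?_
  rw [iSup_image, map_iSup₂, iSup₂_inf_eq]
  refine iSup₂_mono fun κ hκ => le_mulVal ?_
  obtain ⟨x', y', h', hx', hy', e⟩ := (contains_self (σ.restrict _ (hle κ) * τ)).exists_of_mul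
  rw [contains_restrict] at hx'
  rw [le_iff_contains, e]
  refine ((hx'.1.mul hy' h').mono hρ).of_le (hS.1 hκ) ?_
  rw [comp_d]
  exact top_le_iff.1 (hx'.2.ge.trans (OrderHomClass.mono _ inf_le_right))

/-- The product of two composable generalized elements of the locale of germs. The inverse image
of `A` is the join of the `x^*(σ̂) ⊓ y^*(τ̂)` with `σ τ ∈ A`. -/
def germMul (x y : X ⟶ Locale.of G.Completion) (h : Composable x y) :
    X ⟶ Locale.of G.Completion :=
  let φ : FrameHom G.Completion X :=
    extend (mulVal x y) (fun _ _ hσ => mulVal_le.2 fun _ _ hρ => le_mulVal (hρ.trans hσ))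
      (fun _ _ hS => h.mulVal_cover hS)
      (le_of_inf_pull_le (x := x) fun σ => le_of_inf_pull_le (x := y) fun τ => by
        rw [top_inf_eq]
        exact (le_mulVal le_rfl).trans (le_iSup (mulVal x y) (σ * τ)))
      (fun ρ ρ' w hw => by
        rw [← le_himp_iff, mulVal_le]
        intro σ τ hρ
        rw [le_himp_iff, inf_comm, ← le_himp_iff, mulVal_le]
        intro σ' τ' hρ'
        rw [le_himp_iff, inf_inf_inf_comm, ← map_inf, inf_comm]
        refine inf_pull_le fun σ'' hσ => ?_
        rw [inf_comm, ← map_inf]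
        refine inf_pull_le fun τ'' hτ => ?_
        rw [mem_inf] at hσ hτ
        exact (le_mulVal le_rfl).trans (hw _ ((mul_mono hσ.2 hτ.2).trans hρ)
          ((mul_mono hσ.1 hτ.1).trans hρ')))
  ofInvIm φ

theorem pull_germMul_le {x y : X ⟶ Locale.of G.Completion} {h : Composable x y}
    {A : G.Completion} {w : X} :
    pull (germMul x y h) A ≤ w ↔
      ∀ σ τ, σ * τ ∈ A → pull x (hat σ) ⊓ pull y (hat τ) ≤ w := by
  have e : pull (germMul x y h) A = ⨆ ρ ∈ A, mulVal x y ρ := rfl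
  rw [e, iSup₂_le_iff]
  exact ⟨fun h σ τ hA => mulVal_le.1 (h _ hA) σ τ le_rfl,
    fun h ρ hρ => mulVal_le.2 fun σ τ hστ => h σ τ (A.lower hστ hρ)⟩

theorem le_pull_germMul {x y : X ⟶ Locale.of G.Completion} {h : Composable x y}
    {A : G.Completion} {σ τ : G.LocalBisection} (hA : σ * τ ∈ A) :
    pull x (hat σ) ⊓ pull y (hat τ) ≤ pull (germMul x y h) A :=
  pull_germMul_le.1 le_rfl σ τ hA

theorem Composable.precomp {x y : X ⟶ Locale.of G.Completion} (h : Composable x y) (k : Y ⟶ X) :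
    Composable (k ≫ x) (k ≫ y) := by
  have h' := congrArg (k ≫ ·) h
  simpa only [Composable, Category.assoc] using h'

/-- Multiplication of germs is natural, so that it is determined by the universal composable
pair. -/
theorem precomp_germMul (k : Y ⟶ X) (x y : X ⟶ Locale.of G.Completion) (h : Composable x y) :
    k ≫ germMul x y h = germMul (k ≫ x) (k ≫ y) (h.precomp k) := by
  refine hom_ext fun (A : G.Completion) => ?_
  refine le_antisymm ?_ (pull_germMul_le.2 fun σ τ hA => ?_)
  · have e : pull (germMul x y h) A = ⨆ ρ ∈ A, mulVal x y ρ := rfl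
    change invIm k (pull (germMul x y h) A) ≤ _
    simp only [e, mulVal, map_iSup, map_inf]
    refine iSup₂_le fun ρ hρ => iSup₂_le fun σ τ => iSup_le fun hστ => ?_
    exact le_pull_germMul (x := k ≫ x) (y := k ≫ y) (A.lower hστ hρ)
  · rw [pull_comp, pull_comp, ← map_inf]
    exact OrderHomClass.mono (invIm k) (le_pull_germMul (h := h) hA)

/-- On the open where `x` lies in `σ̂` and `y` in `τ̂`, the product in `G` of the images of `x` and
`y` lies in `a` exactly where `x` lies in the part of `σ` over `s_{σ τ}^*(a)`. -/
theorem Composable.pull_inf_invIm_comp {x y : X ⟶ Locale.of G.Completion} (h : Composable x y)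
    (σ τ : G.LocalBisection) (a : G.G₁) :
    pull x (hat σ) ⊓ pull y (hat τ) ⊓ invIm (G.comp (x ≫ germMap G) (y ≫ germMap G) h) a =
      pull x (hat (σ.part (invIm G.str.d (val (invIm (σ * τ).s a))))) ⊓ pull y (hat τ) := by
  set O := pull x (hat σ) ⊓ pull y (hat τ) with hO
  have hx : pull (openIncl O ≫ x) (hat σ) = ⊤ := invIm_openIncl_eq_top.2 inf_le_left
  have hy : pull (openIncl O ≫ y) (hat τ) = ⊤ := invIm_openIncl_eq_top.2 inf_le_right
  have hxy := (contains_comp_germMap hx).mul (contains_comp_germMap hy) (h.precomp (openIncl O))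
  have e := hxy.invIm_eq a
  have e' : openIncl O ≫ G.comp (x ≫ germMap G) (y ≫ germMap G) h =
      G.comp ((openIncl O ≫ x) ≫ germMap G) ((openIncl O ≫ y) ≫ germMap G)
        (h.precomp (openIncl O)) :=
    (precomp_comp _ _ _ _).trans (comp_congr (Category.assoc _ _ _).symm
      (Category.assoc _ _ _).symm _)
  rw [comp_d, ← e', Category.assoc, Category.assoc] at e
  have e₁ := congrArg val e
  rw [invIm_comp, invIm_comp, val_invIm_openIncl, val_invIm_openIncl] at e₁
  rw [inf_comm, e₁, hO, ← inf_assoc, ← pull_j_inf_hat]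
  rfl

/-- The comparison map preserves products. -/
theorem germMul_comp_germMap (x y : X ⟶ Locale.of G.Completion) (h : Composable x y) :
    germMul x y h ≫ germMap G = G.comp (x ≫ germMap G) (y ≫ germMap G) h := by
  refine hom_ext fun a => le_antisymm ?_ ?_
  · refine (pull_germMul_le (A := j a) (h := h)).2 fun σ τ hA => ?_
    refine le_trans (le_inf (h.pull_inf_le σ τ) inf_le_right) ?_
    have hA' : val (invIm (σ * τ).s a) = mulDom σ τ := hA
    have key := h.pull_inf_invIm_comp σ τ a
    have hle : σ.part (invIm G.str.r τ.U) ≤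
        σ.part (invIm G.str.d (val (invIm (σ * τ).s a))) := by
      rw [le_part_iff, mem_j_d, hA']
      exact ⟨part_le _ _, le_rfl⟩
    exact (inf_le_inf_right _ (OrderHomClass.mono (pull x) (hat_mono hle))).trans
      (key.ge.trans inf_le_right)
  · refine le_of_inf_pull_le (x := x) fun σ => le_of_inf_pull_le (x := y) fun τ => ?_
    rw [inf_assoc, inf_comm, h.pull_inf_invIm_comp σ τ a]
    refine le_pull_germMul (A := j a) (h := h) (mem_j.2 ?_)
    obtain ⟨x', y', h', hx', hy', e⟩ := (contains_self
      (σ.part (invIm G.str.d (val (invIm (σ * τ).s a))) * τ)).exists_of_mul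
    rw [contains_part] at hx'
    rw [e, (hx'.1.mul hy' h').invIm_eq, comp_d]
    exact hx'.2

end LocalicGroupoid

namespace LocalicGroupoid

open Locale LocalBisection Completion

variable {G : LocalicGroupoid.{u}} {X Y : Locale.{u}}

/-! ### Charts of the locale of germs -/

/-- The principal element `σ̂` as an open sublocale of the locale of germs, mapped to the domain of
`σ`. -/
def chart (σ : G.LocalBisection) : openSub (X := Locale.of G.Completion) (hat σ) ⟶ openSub σ.U :=
  openLift (openIncl (X := Locale.of G.Completion) (hat σ) ≫ germMap G ≫ G.str.d) σ.U
    (invIm_openIncl_eq_top.2 (hat_le.2 (mem_j_d.2 le_rfl)))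

theorem chart_comp_openIncl (σ : G.LocalBisection) :
    chart σ ≫ openIncl σ.U =
      openIncl (X := Locale.of G.Completion) (hat σ) ≫ germMap G ≫ G.str.d :=
  openLift_comp _ _ _

/-- Since `s_σ` is a section of `d`, the part of `σ` in `d^*(W)` is the restriction to `W`. -/
theorem part_d (σ : G.LocalBisection) {W : G.G₀} (h : W ≤ σ.U) :
    σ.part (invIm G.str.d W) = σ.restrict W h := by
  refine le_antisymm (le_restrict (part_le _ _) ?_) (le_part_iff.2 ⟨restrict_le _ _ _, ?_⟩)
  · exact mem_j_d.1 (le_part_iff.1 le_rfl).2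
  · exact mem_j_d.2 le_rfl

theorem val_invIm_chart (σ : G.LocalBisection) (W : openSub σ.U) :
    val (invIm (chart σ) W) = (hat (σ.restrict (val W) (val_le W)) : G.Completion) := by
  rw [← part_d, ← j_inf_hat]
  rfl

instance (σ : G.LocalBisection) : IsIso (chart σ) := by
  refine isIso_of_bijective _ ⟨fun W W' h => ?_, fun A => ?_⟩
  · have h' := congrArg val h
    rw [val_invIm_chart, val_invIm_chart] at h'
    apply val_injective
    have h₁ : σ.restrict (val W) (val_le W) ≤ σ.restrict (val W') (val_le W') :=
      hat_le.1 (le_of_eq h')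
    have h₂ : σ.restrict (val W') (val_le W') ≤ σ.restrict (val W) (val_le W) :=
      hat_le.1 (ge_of_eq h')
    exact le_antisymm (le_iff.1 h₁).1 (le_iff.1 h₂).1
  · let B : G.Completion := val A
    have hB : ∀ τ ∈ B, τ ≤ σ := fun τ hτ => val_le A hτ
    have hW : sSup (U '' (B : Set G.LocalBisection)) ≤ σ.U := sSup_le (by
      rintro _ ⟨τ, hτ, rfl⟩
      exact (le_iff.1 (hB τ hτ)).1)
    refine ⟨Locale.mk _ hW, val_injective ?_⟩
    rw [val_invIm_chart]
    refine le_antisymm ?_ ?_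
    · refine hat_le.2 (B.closed B _ subset_rfl (isLUB_of_le_sSup (fun τ hτ => ?_) le_rfl))
      exact le_restrict (hB τ hτ) (le_sSup ⟨τ, hτ, rfl⟩)
    · intro τ hτ
      exact le_restrict (hB τ hτ) (le_sSup (Set.mem_image_of_mem U hτ))

/-- The canonical isomorphism from the open sublocale of the unit of the completion to `G₀`. -/
def unitChart (G : LocalicGroupoid.{u}) :
    openSub (X := Locale.of G.Completion) (1 : G.Completion) ⟶ G.G₀ :=
  openIncl (X := Locale.of G.Completion) (1 : G.Completion) ≫ germMap G ≫ G.str.d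

instance : IsIso (unitChart G) := by
  have h : IsIso (openIncl (⊤ : G.G₀)) := isIso_of_bijective _
    ⟨fun a b hab => by simpa using congrArg val hab, (openIncl_isOpenRegularMono _).2⟩
  have e : unitChart G = chart (unit G) ≫ openIncl (⊤ : G.G₀) := (chart_comp_openIncl _).symm
  rw [e]
  exact IsIso.comp_isIso' inferInstance h

theorem val_invIm_unitChart (W : G.G₀) :
    val (invIm (unitChart G) W) = (hat (idem W) : G.Completion) := by
  have h := part_d (unit G) (W := W) le_top
  rw [idem, ← h, ← j_inf_hat]
  rfl

theorem openIncl_one_comp_germMap :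
    openIncl (X := Locale.of G.Completion) (1 : G.Completion) ≫ germMap G =
      unitChart G ≫ G.str.u := by
  have h : pull (openIncl (X := Locale.of G.Completion) (1 : G.Completion)) (hat (unit G)) = ⊤ :=
    invIm_openIncl_eq_top.2 (le_refl (1 : G.Completion))
  have h' := contains_unit.1 (contains_comp_germMap h)
  simpa only [unitChart, Category.assoc] using h'

/-- The map from `G₀` to the locale of germs that assigns to an object the germ of the unit
bisection. -/
def unitGerm (G : LocalicGroupoid.{u}) : G.G₀ ⟶ Locale.of G.Completion :=
  inv (unitChart G) ≫ openIncl (X := Locale.of G.Completion) (1 : G.Completion)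

theorem unitGerm_comp_germMap : unitGerm G ≫ germMap G = G.str.u := by
  rw [unitGerm, Category.assoc, openIncl_one_comp_germMap, IsIso.inv_hom_id_assoc]

theorem pull_unitGerm_one : pull (unitGerm G) (1 : G.Completion) = ⊤ :=
  invIm_eq_top_of_factors (inv (unitChart G))

/-- The unit germs over `W` lie in `A` exactly when the idempotent `ε|_W` belongs to `A`. -/
theorem le_pull_unitGerm {W : G.G₀} {A : G.Completion} :
    W ≤ pull (unitGerm G) A ↔ idem W ∈ A := by
  have h : invIm (unitChart G) (pull (unitGerm G) A) =
      invIm (openIncl (X := Locale.of G.Completion) (1 : G.Completion)) A := by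
    change invIm (unitChart G ≫ unitGerm G) A = _
    rw [unitGerm, IsIso.hom_inv_id_assoc]
  have hW : W ≤ pull (unitGerm G) A ↔
      invIm (unitChart G) W ≤ invIm (unitChart G) (pull (unitGerm G) A) := by
    rw [← inf_eq_left, ← inf_eq_left, ← map_inf]
    exact (bijective_invIm (unitChart G)).1.eq_iff.symm
  have hA : invIm (unitChart G) W ≤
      invIm (openIncl (X := Locale.of G.Completion) (1 : G.Completion)) A ↔
      (hat (idem W) : G.Completion) ≤ A ⊓ 1 := by
    rw [← val_invIm_unitChart]
    rfl
  rw [hW, h, hA, le_inf_iff, hat_le]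
  exact and_iff_left (hat_mono (restrict_le _ _ _))

/-! ### Inverses of germs -/

theorem isLUB_inverse {S : Set G.LocalBisection} {σ : G.LocalBisection} (h : IsLUB S σ) :
    IsLUB (inverse '' S) σ.inverse := by
  refine ⟨?_, fun τ hτ => inverse_le_iff.2 (h.2 fun ρ hρ => ?_)⟩
  · rintro _ ⟨ρ, hρ, rfl⟩
    exact inverse_mono (h.1 hρ)
  · exact inverse_le_iff.1 (hτ ⟨ρ, hρ, rfl⟩)

theorem mem_star {σ : G.LocalBisection} {A : G.Completion} : σ ∈ star A ↔ σ.inverse ∈ A := by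
  let B : G.Completion :=
    { carrier := {τ | τ.inverse ∈ A}
      lower := fun _ _ h hσ => A.lower (inverse_mono h) hσ
      closed := fun S σ hS hσ => A.closed _ _ (Set.image_subset_iff.2 hS) (isLUB_inverse hσ) }
  constructor
  · intro h
    have hB : star A ≤ B := star_le.2 fun τ hτ => by
      change τ.inverse.inverse ∈ A
      rwa [inverse_inverse]
    exact hB h
  · intro h
    rw [← inverse_inverse σ]
    exact star_le.1 le_rfl _ h

/-- Inversion of germs. -/
def germInv (G : LocalicGroupoid.{u}) : Locale.of G.Completion ⟶ Locale.of G.Completion :=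
  let φ : FrameHom G.Completion G.Completion :=
    { toFun := star
      map_inf' := fun A B => SetLike.ext fun σ => by
        rw [mem_star, mem_inf, mem_inf, mem_star, mem_star]
      map_top' := top_le_iff.1 fun σ _ => mem_star.2 (mem_top _)
      map_sSup' := fun s => by
        have h : sSup s ≤ star (sSup (star '' s)) := sSup_le fun A hA σ hσ =>
          mem_star.2 (le_sSup (Set.mem_image_of_mem star hA) (star_le.1 le_rfl σ hσ))
        refine le_antisymm (star_le.2 fun σ hσ => mem_star.1 (h hσ)) (sSup_le ?_)
        rintro _ ⟨A, hA, rfl⟩ σ hσ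
        exact mem_star.2 (le_sSup hA (mem_star.1 hσ)) }
  ofInvIm φ

theorem pull_comp_germInv (x : X ⟶ Locale.of G.Completion) (A : G.Completion) :
    pull (x ≫ germInv G) A = pull x (star A) := rfl

theorem mem_j_inverse {σ : G.LocalBisection} {a : G.G₁} :
    σ.inverse ∈ j a ↔ σ ∈ j (invIm G.str.i a) := by
  rw [mem_j, mem_j, ← invIm_comp]
  constructor
  · intro h
    obtain ⟨k, hk⟩ := (contains_self σ).inverse
    rw [← hk, invIm_comp, h, map_top]
  · intro h
    obtain ⟨k, hk⟩ := contains_inverse.1 (contains_self σ.inverse)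
    rw [← inv_inv σ.inverse.s, ← hk, Category.assoc, invIm_comp, h, map_top]

theorem germInv_comp_germMap : germInv G ≫ germMap G = germMap G ≫ G.str.i :=
  hom_ext fun a => show star (j a) = j (invIm G.str.i a) from SetLike.ext fun σ => by
    rw [mem_star, mem_j_inverse]

theorem germInv_germInv : germInv G ≫ germInv G = 𝟙 _ :=
  hom_ext fun (A : G.Completion) => show star (star A) = A from SetLike.ext fun σ => by
    rw [mem_star, mem_star, inverse_inverse]

/-! ### The groupoid laws for germs -/

theorem germMul_assoc (x y z : X ⟶ Locale.of G.Completion) (hxy : Composable x y)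
    (hyz : Composable y z) (h : Composable (germMul x y hxy) z)
    (h' : Composable x (germMul y z hyz)) :
    germMul (germMul x y hxy) z h = germMul x (germMul y z hyz) h' := by
  refine hom_ext fun (A : G.Completion) => le_antisymm ?_ ?_
  · refine (pull_germMul_le (h := h)).2 fun σ τ hA => ?_
    rw [← le_himp_iff, pull_germMul_le]
    intro σ₁ σ₂ hσ
    rw [le_himp_iff, inf_assoc]
    refine (inf_le_inf_left _ (le_pull_germMul (h := hyz) (mem_hat.2 le_rfl))).trans
      (le_pull_germMul (h := h') (A := A) ?_)
    rw [← LocalBisection.mul_assoc]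
    exact A.lower (mul_mono hσ le_rfl) hA
  · refine (pull_germMul_le (h := h')).2 fun σ τ hA => ?_
    rw [inf_comm, ← le_himp_iff, pull_germMul_le]
    intro τ₁ τ₂ hτ
    rw [le_himp_iff, inf_comm, ← inf_assoc]
    refine (inf_le_inf_right _ (le_pull_germMul (h := hxy) (mem_hat.2 le_rfl))).trans
      (le_pull_germMul (h := h) (A := A) ?_)
    rw [LocalBisection.mul_assoc]
    exact A.lower (mul_mono le_rfl hτ) hA

theorem unitGerm_mul (x : X ⟶ Locale.of G.Completion)
    (h : Composable (x ≫ germMap G ≫ G.str.d ≫ unitGerm G) x) :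
    germMul (x ≫ germMap G ≫ G.str.d ≫ unitGerm G) x h = x := by
  refine hom_ext fun (A : G.Completion) => le_antisymm ?_ ?_
  · refine (pull_germMul_le (h := h)).2 fun σ τ hA => ?_
    have hW : idem (pull (unitGerm G) (hat σ)) ≤ σ :=
      le_pull_unitGerm (A := hat σ).1 le_rfl
    refine (pull_j_inf_hat x τ (invIm G.str.d (pull (unitGerm G) (hat σ)))).le.trans
      (pull_hat_le (A.lower ?_ hA))
    exact (le_idem_mul (mem_j_d.1 (le_part_iff.1 le_rfl).2)).trans (mul_mono hW (part_le _ _))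
  · refine pull_le fun ρ hρ => ?_
    refine le_trans (le_inf ?_ le_rfl)
      (le_pull_germMul (h := h) (A := A) (σ := unit G) (τ := ρ) (A.lower (unit_mul_le ρ) hρ))
    exact le_top.trans_eq ((congrArg (invIm (x ≫ germMap G ≫ G.str.d)) pull_unitGerm_one).trans
      (map_top _)).symm

theorem mul_unitGerm (x : X ⟶ Locale.of G.Completion)
    (h : Composable x (x ≫ germMap G ≫ G.str.r ≫ unitGerm G)) :
    germMul x (x ≫ germMap G ≫ G.str.r ≫ unitGerm G) h = x := by
  refine hom_ext fun (A : G.Completion) => le_antisymm ?_ ?_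
  · refine (pull_germMul_le (h := h)).2 fun σ τ hA => ?_
    have hW : idem (pull (unitGerm G) (hat τ)) ≤ τ :=
      le_pull_unitGerm (A := hat τ).1 le_rfl
    rw [inf_comm]
    refine (pull_j_inf_hat x σ (invIm G.str.r (pull (unitGerm G) (hat τ)))).le.trans
      (pull_hat_le (A.lower ?_ hA))
    exact (le_mul_idem (mem_j_r.1 (le_part_iff.1 le_rfl).2)).trans (mul_mono (part_le _ _) hW)
  · refine pull_le fun ρ hρ => ?_
    refine le_trans (le_inf le_rfl ?_)
      (le_pull_germMul (h := h) (A := A) (σ := ρ) (τ := unit G) (A.lower (mul_unit_le ρ) hρ))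
    exact le_top.trans_eq ((congrArg (invIm (x ≫ germMap G ≫ G.str.r)) pull_unitGerm_one).trans
      (map_top _)).symm

theorem mul_germInv (x : X ⟶ Locale.of G.Completion) (h : Composable x (x ≫ germInv G)) :
    germMul x (x ≫ germInv G) h = x ≫ germMap G ≫ G.str.d ≫ unitGerm G := by
  refine hom_ext fun (A : G.Completion) => le_antisymm ?_ ?_
  · refine (pull_germMul_le (h := h)).2 fun σ τ hA => ?_
    have hle : hat σ ⊓ star (hat τ) ≤ j (invIm G.str.d (pull (unitGerm G) A)) := fun ω hω => by
      rw [mem_inf, mem_star, mem_hat, mem_hat] at hω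
      rw [mem_j_d, le_pull_unitGerm, ← mul_inverse]
      exact A.lower (mul_mono hω.1 hω.2) hA
    rw [pull_comp_germInv, ← map_inf]
    exact OrderHomClass.mono (pull x) hle
  · refine pull_le (x := x) (A := j (invIm G.str.d (pull (unitGerm G) A))) fun ω hω => ?_
    rw [mem_j_d, le_pull_unitGerm, ← mul_inverse] at hω
    refine (le_inf le_rfl ?_).trans (le_pull_germMul (h := h) (A := A) hω)
    rw [pull_comp_germInv]
    exact pull_hat_le (mem_star.2 (mem_hat.2 le_rfl))

theorem germInv_mul (x : X ⟶ Locale.of G.Completion) (h : Composable (x ≫ germInv G) x) :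
    germMul (x ≫ germInv G) x h = x ≫ germMap G ≫ G.str.r ≫ unitGerm G := by
  have e : (x ≫ germInv G) ≫ germInv G = x := by
    rw [Category.assoc, germInv_germInv, Category.comp_id]
  have h' := mul_germInv (x ≫ germInv G) (by rwa [e])
  simp only [e, Category.assoc, reassoc_of% germInv_comp_germMap, reassoc_of% G.str.i_d] at h'
  exact h'

end LocalicGroupoid

namespace LocalicGroupoid

open Locale LocalBisection Completion

variable {G : LocalicGroupoid.{u}} {X Y : Locale.{u}}

/-! ### The groupoid of germs -/

/-- The domain of a germ. -/
def germDom (G : LocalicGroupoid.{u}) :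
    Locale.of G.Completion ⟶ openSub (X := Locale.of G.Completion) (1 : G.Completion) :=
  germMap G ≫ G.str.d ≫ inv (unitChart G)

/-- The range of a germ. -/
def germRan (G : LocalicGroupoid.{u}) :
    Locale.of G.Completion ⟶ openSub (X := Locale.of G.Completion) (1 : G.Completion) :=
  germMap G ≫ G.str.r ≫ inv (unitChart G)

theorem germDom_comp_unitChart : germDom G ≫ unitChart G = germMap G ≫ G.str.d := by
  simp [germDom]

theorem germRan_comp_unitChart : germRan G ≫ unitChart G = germMap G ≫ G.str.r := by
  simp [germRan]

theorem comp_germRan_eq_iff {x y : X ⟶ Locale.of G.Completion} :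
    x ≫ germRan G = y ≫ germDom G ↔ Composable x y := by
  rw [← cancel_mono (unitChart G)]
  simp only [Composable, Category.assoc, germDom_comp_unitChart, germRan_comp_unitChart]

theorem germMul_congr {x x' y y' : X ⟶ Locale.of G.Completion} (hx : x = x') (hy : y = y')
    (h : Composable x y) : germMul x y h = germMul x' y' (by rwa [← hx, ← hy]) := by
  subst hx hy
  rfl

theorem germMul_comp_germDom (x y : X ⟶ Locale.of G.Completion) (h : Composable x y) :
    germMul x y h ≫ germDom G = x ≫ germDom G := by
  simp only [germDom, ← Category.assoc, germMul_comp_germMap, comp_d]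

theorem germMul_comp_germRan (x y : X ⟶ Locale.of G.Completion) (h : Composable x y) :
    germMul x y h ≫ germRan G = y ≫ germRan G := by
  simp only [germRan, ← Category.assoc, germMul_comp_germMap, comp_r]

theorem lift_comp_germMul {x y : X ⟶ Locale.of G.Completion} (h : x ≫ germRan G = y ≫ germDom G) :
    (FiberProd.isPullback (germRan G) (germDom G)).lift x y h ≫
      germMul (FiberProd.fst (germRan G) (germDom G)) (FiberProd.snd (germRan G) (germDom G))
        (comp_germRan_eq_iff.1 (FiberProd.condition _ _)) =
    germMul x y (comp_germRan_eq_iff.1 h) := by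
  rw [precomp_germMul]
  exact germMul_congr (IsPullback.lift_fst _ _ _ _) (IsPullback.lift_snd _ _ _ _) _

/-- The groupoid of germs of local bisections. -/
def germGroupoidStr (G : LocalicGroupoid.{u}) :
    GroupoidStr (openSub (X := Locale.of G.Completion) (1 : G.Completion))
      (Locale.of G.Completion) where
  G₂ := Locale.of (FiberProd (germRan G) (germDom G))
  d := germDom G
  r := germRan G
  u := openIncl (X := Locale.of G.Completion) (1 : G.Completion)
  i := germInv G
  π₁ := FiberProd.fst (germRan G) (germDom G)
  π₂ := FiberProd.snd (germRan G) (germDom G)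
  isPullback := FiberProd.isPullback _ _
  m := germMul _ _ (comp_germRan_eq_iff.1 (FiberProd.condition _ _))
  m_d := germMul_comp_germDom _ _ _
  m_r := germMul_comp_germRan _ _ _
  u_d := by
    rw [germDom]
    have h := IsIso.hom_inv_id (unitChart G)
    simpa only [unitChart, Category.assoc] using h
  u_r := by
    rw [germRan, reassoc_of% openIncl_one_comp_germMap, reassoc_of% G.str.u_r,
      IsIso.hom_inv_id]
  i_d := by
    rw [germDom, reassoc_of% germInv_comp_germMap, reassoc_of% G.str.i_d, germRan]
  i_r := by
    rw [germRan, reassoc_of% germInv_comp_germMap, reassoc_of% G.str.i_r, germDom]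
  unit_left := by
    rw [lift_comp_germMul]
    exact (germMul_congr (by simp [germDom, unitGerm]) rfl _).trans
      (unitGerm_mul (𝟙 _) (by simp [Composable, unitGerm_comp_germMap, G.str.u_r]))
  unit_right := by
    rw [lift_comp_germMul]
    exact (germMul_congr rfl (by simp [germRan, unitGerm]) _).trans
      (mul_unitGerm (𝟙 _) (by simp [Composable, unitGerm_comp_germMap, G.str.u_d]))
  inv_right := by
    rw [lift_comp_germMul]
    exact (germMul_congr rfl (Category.id_comp _).symm _).trans
      ((mul_germInv (𝟙 _) (by simp [Composable, germInv_comp_germMap, G.str.i_d])).trans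
        (by simp [germDom, unitGerm]))
  inv_left := by
    rw [lift_comp_germMul]
    exact (germMul_congr (Category.id_comp _).symm rfl _).trans
      ((germInv_mul (𝟙 _) (by simp [Composable, germInv_comp_germMap, G.str.i_r])).trans
        (by simp [germRan, unitGerm]))
  assoc := fun x y z hxy hyz =>
    (lift_comp_germMul _).trans ((germMul_congr (lift_comp_germMul hxy) rfl _).trans
      ((germMul_assoc x y z _ (comp_germRan_eq_iff.1 hyz) _ (comp_germRan_eq_iff.1 (by
        rw [germMul_comp_germDom, hxy]))).trans
      ((germMul_congr rfl (lift_comp_germMul hyz).symm _).trans (lift_comp_germMul _).symm)))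

/-- The groupoid of germs of local bisections, as a localic groupoid. -/
def germGroupoid (G : LocalicGroupoid.{u}) : LocalicGroupoid.{u} := .mk _ _ (germGroupoidStr G)

theorem invIm_inv_unitChart (b : G.Completion) (hb : b ≤ 1) :
    invIm (inv (unitChart G)) (Locale.mk (X := Locale.of G.Completion) b hb) =
      pull (unitGerm G) b := by
  rw [unitGerm]
  change _ = invIm (inv (unitChart G)) 
    (invIm (openIncl (X := Locale.of G.Completion) (1 : G.Completion)) b)
  congr 1
  exact val_injective (inf_eq_left.2 hb).symm

theorem isGroupoidOfQuantale_germGroupoidStr (G : LocalicGroupoid.{u}) :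
    IsGroupoidOfQuantale (germGroupoidStr G) where
  d_eq b hb := by
    change j (invIm G.str.d (invIm (inv (unitChart G)) _)) = _
    rw [invIm_inv_unitChart]
    refine le_antisymm (fun σ hσ => ?_) (mul_le.2 fun β hβ τ _ => ?_)
    · rw [mem_j_d, le_pull_unitGerm] at hσ
      exact Completion.lower _ (le_idem_mul le_rfl) (mul_mem_mul hσ (mem_top σ))
    · rw [mem_j_d]
      refine le_trans (val_le _ : mulDom β τ ≤ β.U) (le_pull_unitGerm.2 ?_)
      rwa [idem_eq_of_le_unit (hb hβ)]
  r_eq b hb := by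
    change j (invIm G.str.r (invIm (inv (unitChart G)) _)) = _
    rw [invIm_inv_unitChart]
    refine le_antisymm (fun σ hσ => ?_) (mul_le.2 fun τ _ β hβ => ?_)
    · rw [mem_j_r] at hσ
      exact Completion.lower _ (le_mul_idem hσ)
        (mul_mem_mul (mem_top σ) (le_pull_unitGerm.1 le_rfl))
    · obtain ⟨x, y, h, hx, hy, e⟩ := (contains_self (τ * β)).exists_of_mul
      rw [mem_j_r, e, comp_r]
      have hβ' : β.U ≤ pull (unitGerm G) b := by
        rw [le_pull_unitGerm, idem_eq_of_le_unit (hb hβ)]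
        exact hβ
      have hy' := contains_unit.1 (hy.mono (hb hβ))
      rw [hy', Category.assoc, Category.assoc, G.str.u_r, Category.comp_id]
      exact top_le_iff.1 (hy.invIm_d_U.ge.trans (OrderHomClass.mono _ hβ'))
  u_eq _ := rfl
  i_eq _ := rfl
  m_eq a := by
    refine le_antisymm ?_ (sSup_le ?_)
    · exact (pull_germMul_le (A := a) (h := comp_germRan_eq_iff.1 (FiberProd.condition _ _))).2
        fun σ τ h => le_sSup ⟨hat σ, hat τ, mul_le.2 fun σ' hσ τ' hτ =>
          a.lower (mul_mono hσ hτ) h, rfl⟩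
    · rintro _ ⟨x, y, hxy, rfl⟩
      rw [mul_le] at hxy
      refine inf_pull_le (x := FiberProd.snd (germRan G) (germDom G)) (A := y) fun τ hτ => ?_
      refine inf_comm _ _ |>.trans_le (inf_pull_le (x := FiberProd.fst (germRan G) (germDom G))
        (A := x) fun σ hσ => inf_comm _ _ |>.trans_le ?_)
      exact le_pull_germMul (A := a) (h := comp_germRan_eq_iff.1 (FiberProd.condition _ _))
        (hxy σ hσ τ hτ)

theorem isEtale_germGroupoid (G : LocalicGroupoid.{u}) : (germGroupoid G).IsEtale := by
  have h : IsLocalHomeo (germMap G ≫ G.str.d) := by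
    refine ⟨Set.range (hat : G.LocalBisection → G.Completion), ?_, ?_⟩
    · exact top_le_iff.1 fun σ _ => hat_le.1 (le_sSup ⟨σ, rfl⟩)
    · rintro _ ⟨σ, rfl⟩
      rw [← chart_comp_openIncl]
      exact (isOpenRegularMono_of_isIso _).comp (openIncl_isOpenRegularMono _)
  have h' := h.comp_iso (inv (unitChart G))
  rwa [Category.assoc] at h'

/-- The functor from the groupoid of germs to `G`. -/
def germFunctor (G : LocalicGroupoid.{u}) : germGroupoid G ⟶ G :=
  show Hom (germGroupoid G) G from
  { f₀ := unitChart G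
    f₁ := germMap G
    comm_d := germDom_comp_unitChart
    comm_r := germRan_comp_unitChart
    comm_u := openIncl_one_comp_germMap
    comm_m := germMul_comp_germMap _ _ _ }

/-! ### Epimorphisms and isomorphisms of localic groupoids -/

theorem epi_of_injective {H K : LocalicGroupoid.{u}} (F : H ⟶ K) [IsIso (Hom.f₀ F)]
    (h : Function.Injective (invIm (Hom.f₁ F))) : Epi F where
  left_cancellation {L} A B hAB := by
    have h₀ : Hom.f₀ F ≫ Hom.f₀ A = Hom.f₀ F ≫ Hom.f₀ B := congrArg Hom.f₀ hAB
    have h₁ : Hom.f₁ F ≫ Hom.f₁ A = Hom.f₁ F ≫ Hom.f₁ B := congrArg Hom.f₁ hAB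
    refine Hom.ext ((cancel_epi _).1 h₀) (hom_ext fun a => h ?_)
    rw [← invIm_comp, h₁, invIm_comp]

theorem isIso_of_isIso {H K : LocalicGroupoid.{u}} (F : H ⟶ K) [IsIso (Hom.f₀ F)]
    [IsIso (Hom.f₁ F)] : IsIso F := by
  have hd := Hom.comm_d F
  have hr := Hom.comm_r F
  have hd' : K.str.d ≫ inv (Hom.f₀ F) = inv (Hom.f₁ F) ≫ H.str.d := by
    rw [IsIso.comp_inv_eq, Category.assoc, hd, IsIso.inv_hom_id_assoc]
  have hr' : K.str.r ≫ inv (Hom.f₀ F) = inv (Hom.f₁ F) ≫ H.str.r := by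
    rw [IsIso.comp_inv_eq, Category.assoc, hr, IsIso.inv_hom_id_assoc]
  let F' : Hom K H :=
    { f₀ := inv (Hom.f₀ F)
      f₁ := inv (Hom.f₁ F)
      comm_d := hd'
      comm_r := hr'
      comm_u := by
        rw [IsIso.comp_inv_eq, Category.assoc, Hom.comm_u F, IsIso.inv_hom_id_assoc]
      comm_m := by
        rw [IsIso.comp_inv_eq, Hom.map_comp F]
        have e : K.str.isPullback.lift K.str.π₁ K.str.π₂ K.str.isPullback.w = 𝟙 _ :=
          K.str.isPullback.hom_ext (by simp) (by simp)
        rw [← Category.id_comp K.str.m, ← e]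
        exact comp_congr (by simp) (by simp) _ }
  exact ⟨F', Hom.ext (IsIso.hom_inv_id _) (IsIso.hom_inv_id _),
    Hom.ext (IsIso.inv_hom_id _) (IsIso.inv_hom_id _)⟩

theorem isEtale_of_iso {H K : LocalicGroupoid.{u}} (F : H ⟶ K) [IsIso F] (hH : H.IsEtale) :
    K.IsEtale := by
  have : IsIso (Hom.f₀ F) := ⟨Hom.f₀ (inv F), congrArg Hom.f₀ (IsIso.hom_inv_id F),
    congrArg Hom.f₀ (IsIso.inv_hom_id F)⟩
  have : IsIso (Hom.f₁ F) := ⟨Hom.f₁ (inv F), congrArg Hom.f₁ (IsIso.hom_inv_id F),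
    congrArg Hom.f₁ (IsIso.inv_hom_id F)⟩
  have h : K.str.d = inv (Hom.f₁ F) ≫ H.str.d ≫ Hom.f₀ F := by
    rw [Hom.comm_d F, IsIso.inv_hom_id_assoc]
  rw [IsEtale, h]
  exact (IsLocalHomeo.comp_iso hH _).iso_comp _

/-- In an étale groupoid every local bisection is an open embedding; its image is the open whose
members are the restrictions of the bisection. -/
theorem exists_j_eq_hat (hG : G.IsEtale) (σ : G.LocalBisection) : ∃ a, j a = hat σ := by
  obtain ⟨C, hC, h⟩ := hG
  -- On a member `c` of the cover `d` is injective, so the image of `σ` meets `c` in the part of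
  -- `c` over `s_σ^*(c)`.
  refine ⟨⨆ c ∈ C, c ⊓ invIm G.str.d (val (invIm σ.s c)), le_antisymm (fun τ hτ => ?_)
    (hat_le.2 (mem_j.2 ?_))⟩
  · have hτ' : val (invIm τ.s (⨆ c ∈ C, c ⊓ invIm G.str.d (val (invIm σ.s c)))) = τ.U := hτ
    rw [← sSup_image, map_sSup, val_sSup] at hτ'
    refine Completion.closed _ ((fun c => τ.part (c ⊓ invIm G.str.d (val (invIm σ.s c)))) '' C) τ
      ?_ (isLUB_of_le_sSup ?_ ?_)
    · rintro _ ⟨c, hc, rfl⟩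
      set ω := τ.part (c ⊓ invIm G.str.d (val (invIm σ.s c)))
      have hω : ω ∈ j (c ⊓ invIm G.str.d (val (invIm σ.s c))) := (le_part_iff.1 le_rfl).2
      rw [mem_j, map_inf, inf_eq_top_iff] at hω
      have hωc := hω.1
      have hωσ := mem_j_d.1 (mem_j.2 hω.2)
      have hωσ' : ω.U ≤ σ.U := hωσ.trans (val_le _)
      have hσc : invIm (openInclLE hωσ' ≫ σ.s) c = ⊤ := by
        refine val_injective ?_
        rw [invIm_comp, val_invIm_openInclLE, val_top]
        exact inf_eq_right.2 hωσ
      have e : openLift ω.s c hωc = openLift (openInclLE hωσ' ≫ σ.s) c hσc := by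
        refine cancel_right_of_surjective (h c hc).2 ?_
        rw [← Category.assoc, ← Category.assoc, openLift_comp, openLift_comp, ω.s_d,
          Category.assoc, σ.s_d, openInclLE_comp]
      refine ⟨hωσ', ?_⟩
      rw [← openLift_comp (openInclLE hωσ' ≫ σ.s) c hσc, ← e, openLift_comp]
    · rintro _ ⟨c, -, rfl⟩
      exact part_le _ _
    · rw [← hτ', Set.image_image, Set.image_image, Set.image_image]
      exact le_rfl
  · have h' : ∀ c, invIm σ.s (c ⊓ invIm G.str.d (val (invIm σ.s c))) = invIm σ.s c := fun c => by
      rw [map_inf, ← invIm_comp σ.s G.str.d, σ.s_d, inf_eq_left, ← val_le_val,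
        val_invIm_openIncl]
      exact le_inf le_rfl (val_le _)
    simp only [map_iSup, h']
    rw [← sSup_image, ← map_sSup, hC, map_top]

theorem surjective_j (hG : G.IsEtale) : Function.Surjective (j : G.G₁ → G.Completion) := fun A => by
  choose f hf using exists_j_eq_hat hG
  refine ⟨⨆ σ ∈ A, f σ, ?_⟩
  rw [← invIm_germMap]
  simp only [map_iSup, invIm_germMap, hf]
  exact le_antisymm (iSup₂_le fun σ hσ => hat_le.2 hσ) (le_iSup_hat A)

end LocalicGroupoid

end

open LocalicGroupoid Locale in
theorem mainTheorem9 (G : LocalicGroupoid.{u}) (hG : G.IsOpen) (hw : G.IsWeaklyCoverable)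
    (hb : G.HasEnoughBisections) :
    ∃ S : GroupoidStr (openSub (X := Locale.of G.Completion) (1 : G.Completion))
        (Locale.of G.Completion),
      IsGroupoidOfQuantale S ∧
      (LocalicGroupoid.mk _ _ S).IsEtale ∧
      ∃ J : LocalicGroupoid.mk _ _ S ⟶ G,
        IsIso (Hom.f₀ J) ∧
        (∀ U : G.G₀, val (invIm (Hom.f₀ J) U) =
          Completion.hat ((LocalBisection.unit G).restrict U le_top)) ∧
        (∀ a : G.G₁, invIm (Hom.f₁ J) a = j a) ∧
        Epi J ∧
        (IsIso J ↔ G.IsEtale) := by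
  have h₀ : IsIso (Hom.f₀ (germFunctor G)) := inferInstanceAs (IsIso (unitChart G))
  refine ⟨germGroupoidStr G, isGroupoidOfQuantale_germGroupoidStr G, isEtale_germGroupoid G,
    germFunctor G, h₀, val_invIm_unitChart, fun _ => rfl, epi_of_injective (germFunctor G) hb,
    fun h => ?_, fun h => ?_⟩
  · have h' : IsIso (germFunctor G) := h
    exact isEtale_of_iso (germFunctor G) (isEtale_germGroupoid G)
  · have h₁ : IsIso (Hom.f₁ (germFunctor G)) := isIso_of_bijective (germMap G) ⟨hb, surjective_j h⟩
    exact isIso_of_isIso (germFunctor G)
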